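/- Let $K$ be an algebraically closed field of characteristic zero (for instance $K=\mathbb{C}$), and let $X\subseteq\mathbb{P}^n_K$ be a projective curve, i.e. an irreducible, reduced, Zariski-closed subvariety of dimension $1$. Let $$\sigma_2(X)=\overline{\bigcup_{P_1,P_2\in X}\langle P_1,P_2\rangle}\subseteq\mathbb{P}^n_K$$ be its secant variety, where $\langle P_1,P_2\rangle$ is the linear span of the two points and the bar denotes Zariski closure. (1) $\dim\sigma_2(X)=3$ unless $X$ lies in a plane; precisely, $\dim\sigma_2(X)=3$ if and only if $X$ is not contained in a linear subspace of $\mathbb{P}^n_K$ of dimension at most $2$. (2) If $X$ is smooth, then $X$ is isomorphic, as an algebraic variety, to a projective curve $Y\subseteq\mathbb{P}^3_K$. -/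

import Mathlib

noncomputable section

/-- Projective `n`-space over the field `K`: the lines through the origin in `K ^ (n + 1)`. -/
def ProjSpace (K : Type*) [Field K] (n : ℕ) : Type _ :=
  Projectivization K (Fin (n + 1) → K)

namespace ProjSpace

variable {K : Type*} [Field K] {n m : ℕ}

/-- A nonzero vector of homogeneous coordinates of a point. -/
def coords (p : ProjSpace K n) : Fin (n + 1) → K := Projectivization.rep p

theorem coords_ne_zero (p : ProjSpace K n) : p.coords ≠ 0 := Projectivization.rep_nonzero p

/-- The point with homogeneous coordinates `v`. -/
def ofCoords (v : Fin (n + 1) → K) (hv : v ≠ 0) : ProjSpace K n := Projectivization.mk K v hv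

/-- The line in `K ^ (n + 1)` which is the point `p`. -/
def line (p : ProjSpace K n) : Submodule K (Fin (n + 1) → K) := Projectivization.submodule p

/-- The common zero locus of a set of polynomials (used for homogeneous polynomials only, where
the choice of the coordinate vectors does not matter). -/
def zeroLocus (S : Set (MvPolynomial (Fin (n + 1)) K)) : Set (ProjSpace K n) :=
  {p | ∀ F ∈ S, MvPolynomial.eval p.coords F = 0}

/-- Projective algebraic sets: the common zero loci of sets of homogeneous polynomials. -/
def IsAlgebraicSet (Z : Set (ProjSpace K n)) : Prop :=
  ∃ S : Set (MvPolynomial (Fin (n + 1)) K), (∀ F ∈ S, ∃ d : ℕ, F.IsHomogeneous d) ∧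
    Z = zeroLocus S

theorem isAlgebraicSet_empty : IsAlgebraicSet (∅ : Set (ProjSpace K n)) := by
  refine ⟨{1}, ?_, ?_⟩
  · rintro F rfl
    exact ⟨0, MvPolynomial.isHomogeneous_one _ _⟩
  · ext p
    simp [zeroLocus]

theorem isAlgebraicSet_sInter (A : Set (Set (ProjSpace K n))) (hA : ∀ Z ∈ A, IsAlgebraicSet Z) :
    IsAlgebraicSet (⋂₀ A) := by
  choose! S hS hZ using hA
  refine ⟨⋃ Z ∈ A, S Z, ?_, ?_⟩
  · intro F hF
    simp only [Set.mem_iUnion] at hF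
    obtain ⟨Z, hZA, hF⟩ := hF
    exact hS Z hZA F hF
  · ext p
    simp only [Set.mem_sInter, zeroLocus, Set.mem_iUnion, Set.mem_ofPred_eq]
    constructor
    · rintro h F ⟨Z, hZA, hF⟩
      have hp := h Z hZA
      rw [hZ Z hZA] at hp
      exact hp F hF
    · intro h Z hZA
      rw [hZ Z hZA]
      exact fun F hF => h F ⟨Z, hZA, hF⟩

theorem isAlgebraicSet_union (Z W : Set (ProjSpace K n)) (hZ : IsAlgebraicSet Z)
    (hW : IsAlgebraicSet W) : IsAlgebraicSet (Z ∪ W) := by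
  obtain ⟨S, hS, rfl⟩ := hZ
  obtain ⟨T, hT, rfl⟩ := hW
  refine ⟨{H | ∃ F ∈ S, ∃ G ∈ T, H = F * G}, ?_, ?_⟩
  · rintro H ⟨F, hF, G, hG, rfl⟩
    obtain ⟨d, hd⟩ := hS F hF
    obtain ⟨e, he⟩ := hT G hG
    exact ⟨d + e, hd.mul he⟩
  · ext p
    constructor
    · rintro (h | h)
      · rintro H ⟨F, hF, G, hG, rfl⟩
        rw [map_mul, h F hF, zero_mul]
      · rintro H ⟨F, hF, G, hG, rfl⟩
        rw [map_mul, h G hG, mul_zero]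
    · intro h
      by_contra hc
      rw [Set.mem_union, not_or] at hc
      simp only [zeroLocus, Set.mem_ofPred_eq, not_forall] at hc
      obtain ⟨⟨F, hF, hF0⟩, ⟨G, hG, hG0⟩⟩ := hc
      have := h (F * G) ⟨F, hF, G, hG, rfl⟩
      rw [map_mul] at this
      exact (mul_ne_zero hF0 hG0) this

/-- The Zariski topology: the closed sets are the projective algebraic sets. -/
instance zariskiTopology : TopologicalSpace (ProjSpace K n) :=
  TopologicalSpace.ofClosed {Z | IsAlgebraicSet Z} isAlgebraicSet_empty
    (fun A hA => isAlgebraicSet_sInter A hA) (fun Z hZ W hW => isAlgebraicSet_union Z W hZ hW)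

/-- A projective curve: an irreducible Zariski-closed subset of dimension one
(with its reduced structure). -/
structure IsCurve (X : Set (ProjSpace K n)) : Prop where
  isClosed : IsClosed X
  isIrreducible : IsIrreducible X
  dim_eq_one : topologicalKrullDim X = 1

/-- The `s`-th secant variety: the Zariski closure of the union of the linear spans
`⟨P₁, …, Pₛ⟩` over all points `P₁, …, Pₛ` of `X`. -/
def secantVariety (s : ℕ) (X : Set (ProjSpace K n)) : Set (ProjSpace K n) :=
  closure {q | ∃ P : Fin s → ProjSpace K n, (∀ i, P i ∈ X) ∧ q.line ≤ ⨆ i, (P i).line}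

/-- `X` is contained in a plane, i.e. in a linear subspace of projective dimension at most two. -/
def LiesInPlane (X : Set (ProjSpace K n)) : Prop :=
  ∃ W : Submodule K (Fin (n + 1) → K), Module.finrank K W ≤ 3 ∧ ∀ p ∈ X, p.line ≤ W

/-- The linear subspace of `K ^ (n + 1)` whose projectivization is the embedded tangent space of
`X` at `p`: the common kernel of the differentials at `p` of all forms vanishing on `X`. -/
def tangentSpace (X : Set (ProjSpace K n)) (p : ProjSpace K n) :
    Submodule K (Fin (n + 1) → K) where
  carrier := {w | ∀ (d : ℕ) (F : MvPolynomial (Fin (n + 1)) K), F.IsHomogeneous d →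
    (∀ q ∈ X, MvPolynomial.eval q.coords F = 0) →
      ∑ i, w i * MvPolynomial.eval p.coords (MvPolynomial.pderiv i F) = 0}
  zero_mem' := by
    intro d F _ _
    simp
  add_mem' := by
    intro a b ha hb d F hF hX
    simp only [Pi.add_apply, add_mul, Finset.sum_add_distrib, ha d F hF hX, hb d F hF hX, add_zero]
  smul_mem' := by
    intro c a ha d F hF hX
    simp only [Pi.smul_apply, smul_eq_mul, mul_assoc, ← Finset.mul_sum, ha d F hF hX, mul_zero]

/-- `X` is smooth: at each point the embedded tangent space has the same (projective) dimension
as `X`. Meant for irreducible closed `X`. -/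
def IsSmooth (X : Set (ProjSpace K n)) : Prop :=
  ∀ p ∈ X, (Module.finrank K (tangentSpace X p) : WithBot ℕ∞) = topologicalKrullDim X + 1

/-- Regular maps (morphisms) between projective algebraic sets: near each point of `X` the map is
given by homogeneous polynomials of one common degree without common zeros. -/
def IsRegularMap (X : Set (ProjSpace K n)) (Y : Set (ProjSpace K m)) (f : X → Y) : Prop :=
  ∀ x : X, ∃ U : Set (ProjSpace K n), IsOpen U ∧ (x : ProjSpace K n) ∈ U ∧
    ∃ (d : ℕ) (F : Fin (m + 1) → MvPolynomial (Fin (n + 1)) K), (∀ i, (F i).IsHomogeneous d) ∧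
      ∀ y : X, (y : ProjSpace K n) ∈ U →
        ∃ h : (fun i => MvPolynomial.eval (y : ProjSpace K n).coords (F i)) ≠ 0,
          (f y : ProjSpace K m) = ofCoords _ h

/-- Isomorphism of projective algebraic sets: mutually inverse regular maps. -/
def AreIsomorphic (X : Set (ProjSpace K n)) (Y : Set (ProjSpace K m)) : Prop :=
  ∃ e : X ≃ Y, IsRegularMap X Y e ∧ IsRegularMap Y X e.symm

end ProjSpace

end

/-!
The theorem is proved with the affine cones `cone Z ⊆ K ^ (n + 1)` of closed sets `Z` and their
rings of polynomial functions `CoordRing Z`. Both parts rest on one finiteness statement: if linear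
forms `l` have no common zero on `Z`, then by the Nullstellensatz `CoordRing Z` is a finite module
over the polynomial ring in `l` (`formsHom_finite`). Since transcendence degrees drop strictly along
chains of primes, a closed set `Z` with `k` such forms has dimension less than `k`
(`NoCommonZero.dim_lt`); conversely `exists_noCommonZero` gives `k` such forms whenever
`dim Z < k`, by avoiding the finitely many irreducible components one form at a time.

The secant variety is the join of `X` with itself, that is the closure of the image of
`cone X + cone X`. It is irreducible, and its function ring embeds into that of the product of two
copies of the cone, which is integral over a polynomial ring in `2 + 2` variables; so its dimension
is at most `3` (`IsCurve.dim_join_lt_four`). If `X` lies in a plane, then so does the secant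
variety; for dimension `3` this is too small, as coordinates of the `3`-dimensional span are
forms without common zeros. If `X` does not lie in a plane, then for suitable points the chain
`{p} ⊂ X ⊂ join {p} X ⊂ join X X` is strict, which gives dimension at least `3`.

For a smooth curve choose four linear forms without common zero on the secant variety. They define
a map `linProj` from `X` to projective `3`-space. It is injective, as the difference of two points
of the cone lies on a secant. It is unramified, as the embedded tangent lines lie in the secant
variety (`IsCurve.mem_cone_join_of_mem_tangentSpace`), so that the four forms and the differentials
of the equations of `X` span all linear forms. It is finite and closed. By Nakayama's lemma the
coordinates of `X` are, locally on the image, polynomials in the four forms (`exists_inverse_forms`),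
which is to say that the inverse of the projection is regular.
-/

namespace ProjSpace

open TopologicalSpace Topology
open scoped Pointwise

variable {K : Type*} [Field K] {n m : ℕ}

/-! ### Homogeneous components and restriction to lines through the origin -/

section Homogeneous

variable {σ : Type*}

theorem mem_vanishingIdeal {D : Set (σ → K)} {F : MvPolynomial σ K} :
    F ∈ MvPolynomial.vanishingIdeal K D ↔ ∀ v ∈ D, MvPolynomial.eval v F = 0 := by
  simp [MvPolynomial.mem_vanishingIdeal_iff, MvPolynomial.aeval_eq_eval]

/-- The restriction of `F` to the line `T ↦ T • v` is a polynomial in `T` whose coefficients are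
the values at `v` of the homogeneous components of `F`. -/
theorem coeff_aeval_C_mul_X (F : MvPolynomial σ K) (v : σ → K) (d : ℕ) :
    (MvPolynomial.aeval (fun i => Polynomial.C (v i) * Polynomial.X) F).coeff d =
      MvPolynomial.eval v (MvPolynomial.homogeneousComponent d F) := by
  induction F using MvPolynomial.induction_on' with
  | monomial m c =>
    have hm : MvPolynomial.monomial m c ∈ MvPolynomial.homogeneousSubmodule σ K m.degree :=
      MvPolynomial.isHomogeneous_monomial c rfl
    have : MvPolynomial.aeval (fun i => Polynomial.C (v i) * Polynomial.X)
        (MvPolynomial.monomial m c) =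
        Polynomial.C (c * m.prod fun i k => v i ^ k) * Polynomial.X ^ m.degree := by
      rw [MvPolynomial.aeval_monomial]
      simp only [mul_pow, Finsupp.prod, Finset.prod_mul_distrib, Finset.prod_pow_eq_pow_sum,
        Finsupp.degree, map_mul, map_prod, map_pow, mul_assoc]
      rfl
    rw [this, Polynomial.coeff_C_mul_X_pow, MvPolynomial.homogeneousComponent_of_mem hm]
    split_ifs <;> simp [MvPolynomial.eval_monomial]
  | add p q hp hq => simp [hp, hq]

theorem eval_aeval_C_mul_X (F : MvPolynomial σ K) (v : σ → K) (t : K) :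
    (MvPolynomial.aeval (fun i => Polynomial.C (v i) * Polynomial.X) F).eval t =
      MvPolynomial.eval (t • v) F := by
  have : (Polynomial.aeval t).comp
      (MvPolynomial.aeval (fun i => Polynomial.C (v i) * Polynomial.X)) =
      MvPolynomial.aeval (R := K) (t • v) := by
    ext i
    rw [AlgHom.comp_apply, MvPolynomial.aeval_X, MvPolynomial.aeval_X, map_mul,
      Polynomial.aeval_C, Polynomial.aeval_X, Pi.smul_apply, smul_eq_mul, mul_comm]
    rfl
  rw [← MvPolynomial.aeval_eq_eval]
  change _ = MvPolynomial.aeval (t • v) F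
  rw [← this, AlgHom.comp_apply, Polynomial.coe_aeval_eq_eval]

theorem eval_smul_of_isHomogeneous {F : MvPolynomial σ K} {d : ℕ} (hF : F.IsHomogeneous d)
    (t : K) (v : σ → K) :
    MvPolynomial.eval (t • v) F = t ^ d * MvPolynomial.eval v F := by
  have : MvPolynomial.aeval (fun i => Polynomial.C (v i) * Polynomial.X) F =
      Polynomial.C (MvPolynomial.eval v F) * Polynomial.X ^ d := by
    ext e
    rw [coeff_aeval_C_mul_X, Polynomial.coeff_C_mul_X_pow,
      MvPolynomial.homogeneousComponent_of_mem ((MvPolynomial.mem_homogeneousSubmodule d F).2 hF)]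
    split_ifs <;> simp
  rw [← eval_aeval_C_mul_X, this, Polynomial.eval_C_mul, Polynomial.eval_pow, Polynomial.eval_X,
    mul_comm]

theorem homogeneousComponent_mem_vanishingIdeal [Infinite K] {D : Set (σ → K)}
    (hD : ∀ (t : K), ∀ v ∈ D, t • v ∈ D) {F : MvPolynomial σ K}
    (hF : F ∈ MvPolynomial.vanishingIdeal K D) (d : ℕ) :
    MvPolynomial.homogeneousComponent d F ∈ MvPolynomial.vanishingIdeal K D := by
  rw [mem_vanishingIdeal] at hF ⊢
  intro v hv
  have : MvPolynomial.aeval (fun i => Polynomial.C (v i) * Polynomial.X) F = 0 :=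
    Polynomial.funext fun t => by
      rw [eval_aeval_C_mul_X, hF _ (hD t v hv), Polynomial.eval_zero]
  rw [← coeff_aeval_C_mul_X, this, Polynomial.coeff_zero]

theorem eval_eq_sum_homogeneousComponent (F : MvPolynomial σ K) (v : σ → K) :
    MvPolynomial.eval v F = ∑ d ∈ Finset.range (F.totalDegree + 1),
      MvPolynomial.eval v (MvPolynomial.homogeneousComponent d F) := by
  conv_lhs => rw [← MvPolynomial.sum_homogeneousComponent F, map_sum]

/-- A polynomial which does not vanish at `v` has a homogeneous component with this property. -/
theorem exists_eval_homogeneousComponent_ne_zero {F : MvPolynomial σ K} {v : σ → K}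
    (h : MvPolynomial.eval v F ≠ 0) :
    ∃ d, MvPolynomial.eval v (MvPolynomial.homogeneousComponent d F) ≠ 0 := by
  by_contra! hc
  exact h (by rw [eval_eq_sum_homogeneousComponent]; exact Finset.sum_eq_zero fun d _ => hc d)

end Homogeneous

/-! ### Affine cones -/

/-- The affine cone over `Z`, a subset of `K ^ (n + 1)`; it contains the origin. -/
def cone (Z : Set (ProjSpace K n)) : Set (Fin (n + 1) → K) :=
  {v | ∀ hv : v ≠ 0, ofCoords v hv ∈ Z}

theorem ofCoords_coords (p : ProjSpace K n) : ofCoords p.coords p.coords_ne_zero = p :=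
  Projectivization.mk_rep p

theorem ofCoords_eq_iff {v w : Fin (n + 1) → K} (hv : v ≠ 0) (hw : w ≠ 0) :
    ofCoords v hv = ofCoords w hw ↔ ∃ t : K, t • w = v :=
  Projectivization.mk_eq_mk_iff' K v w hv hw

theorem ofCoords_smul {v : Fin (n + 1) → K} {t : K} (h : t • v ≠ 0) :
    ofCoords (t • v) h = ofCoords v (right_ne_zero_of_smul h) :=
  (ofCoords_eq_iff _ _).2 ⟨t, rfl⟩

theorem exists_coords_ofCoords {v : Fin (n + 1) → K} (hv : v ≠ 0) :
    ∃ t : K, t ≠ 0 ∧ (ofCoords v hv).coords = t • v := by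
  obtain ⟨a, ha⟩ := Projectivization.exists_smul_eq_mk_rep K v hv
  exact ⟨a, a.ne_zero, ha.symm⟩

theorem eq_of_coords_eq_smul {p q : ProjSpace K n} {t : K} (h : p.coords = t • q.coords) :
    p = q := by
  rw [← ofCoords_coords p, ← ofCoords_coords q, ofCoords_eq_iff]
  exact ⟨t, h.symm⟩

theorem zero_mem_cone (Z : Set (ProjSpace K n)) : (0 : Fin (n + 1) → K) ∈ cone Z :=
  fun h => (h rfl).elim

theorem smul_mem_cone {Z : Set (ProjSpace K n)} (t : K) {v : Fin (n + 1) → K} (hv : v ∈ cone Z) :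
    t • v ∈ cone Z := fun h => by
  rw [ofCoords_smul]
  exact hv _

theorem coords_mem_cone {Z : Set (ProjSpace K n)} {p : ProjSpace K n} :
    p.coords ∈ cone Z ↔ p ∈ Z := by
  constructor
  · intro h
    have := h p.coords_ne_zero
    rwa [ofCoords_coords] at this
  · intro h hv
    rwa [ofCoords_coords]

theorem cone_mono {Z W : Set (ProjSpace K n)} (h : Z ⊆ W) : cone Z ⊆ cone W :=
  fun _ hv h0 => h (hv h0)

theorem subset_of_cone_subset {Z W : Set (ProjSpace K n)} (h : cone Z ⊆ cone W) : Z ⊆ W :=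
  fun _ hp => coords_mem_cone.1 (h (coords_mem_cone.2 hp))

theorem cone_singleton (p : ProjSpace K n) : cone {p} = {v | ∃ t : K, v = t • p.coords} := by
  ext v
  constructor
  · intro h
    by_cases hv : v = 0
    · exact ⟨0, by simp [hv]⟩
    · have := h hv
      rw [Set.mem_singleton_iff, ← ofCoords_coords p, ofCoords_eq_iff] at this
      obtain ⟨t, ht⟩ := this
      exact ⟨t, ht.symm⟩
  · rintro ⟨t, rfl⟩
    exact smul_mem_cone t (coords_mem_cone.2 rfl)

theorem mem_line_iff {p : ProjSpace K n} {v : Fin (n + 1) → K} :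
    v ∈ p.line ↔ ∃ t : K, v = t • p.coords := by
  rw [show p.line = Submodule.span K {p.coords} from Projectivization.submodule_eq p,
    Submodule.mem_span_singleton]
  exact ⟨fun ⟨t, h⟩ => ⟨t, h.symm⟩, fun ⟨t, h⟩ => ⟨t, h.symm⟩⟩

/-! ### Closed and irreducible sets in terms of the ideals of the cones -/

theorem isClosed_iff {Z : Set (ProjSpace K n)} : IsClosed Z ↔ IsAlgebraicSet Z := by
  rw [← isOpen_compl_iff]
  change IsAlgebraicSet Zᶜᶜ ↔ _
  rw [compl_compl]

/-- The homogeneous ideal of `Z`, as the vanishing ideal of its affine cone. -/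
noncomputable def coneIdeal (Z : Set (ProjSpace K n)) : Ideal (MvPolynomial (Fin (n + 1)) K) :=
  MvPolynomial.vanishingIdeal K (cone Z)

theorem mem_coneIdeal {Z : Set (ProjSpace K n)} {F : MvPolynomial (Fin (n + 1)) K} :
    F ∈ coneIdeal Z ↔ ∀ v ∈ cone Z, MvPolynomial.eval v F = 0 := mem_vanishingIdeal

theorem coneIdeal_anti {Z W : Set (ProjSpace K n)} (h : Z ⊆ W) : coneIdeal W ≤ coneIdeal Z :=
  MvPolynomial.vanishingIdeal_anti_mono (cone_mono h)

theorem isClosed_zeroLocus_singleton {F : MvPolynomial (Fin (n + 1)) K} {d : ℕ}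
    (hF : F.IsHomogeneous d) : IsClosed (zeroLocus {F}) :=
  isClosed_iff.2 ⟨{F}, by rintro _ rfl; exact ⟨d, hF⟩, rfl⟩

theorem eval_coords_ofCoords_eq_zero_iff {F : MvPolynomial (Fin (n + 1)) K} {d : ℕ}
    (hF : F.IsHomogeneous d) {v : Fin (n + 1) → K} (hv : v ≠ 0) :
    MvPolynomial.eval (ofCoords v hv).coords F = 0 ↔ MvPolynomial.eval v F = 0 := by
  obtain ⟨t, ht, h⟩ := exists_coords_ofCoords hv
  rw [h, eval_smul_of_isHomogeneous hF]
  simp [ht]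

theorem exists_coord_ne_zero {v : Fin (n + 1) → K} (hv : v ≠ 0) : ∃ i, v i ≠ 0 :=
  Function.ne_iff.1 hv

theorem mem_cone_iff_of_isClosed {Z : Set (ProjSpace K n)} (hZ : IsClosed Z)
    {v : Fin (n + 1) → K} :
    v ∈ cone Z ↔ ∀ F ∈ coneIdeal Z, MvPolynomial.eval v F = 0 := by
  refine ⟨fun hv F hF => mem_coneIdeal.1 hF v hv, fun h hv => ?_⟩
  obtain ⟨S, hS, rfl⟩ := isClosed_iff.1 hZ
  intro F hF
  obtain ⟨d, hd⟩ := hS F hF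
  rw [eval_coords_ofCoords_eq_zero_iff hd]
  obtain ⟨i, hi⟩ := exists_coord_ne_zero hv
  -- `F` may be a constant when `Z` is empty; `x i * F` vanishes at the origin in any case
  have : MvPolynomial.X i * F ∈ coneIdeal (zeroLocus S) := by
    rw [mem_coneIdeal]
    intro w hw
    by_cases hw0 : w = 0
    · simp [hw0]
    · rw [map_mul, (eval_coords_ofCoords_eq_zero_iff hd hw0).1 (hw hw0 F hF), mul_zero]
  simpa [hi] using h _ this

theorem mem_iff_of_isClosed {Z : Set (ProjSpace K n)} (hZ : IsClosed Z) {p : ProjSpace K n} :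
    p ∈ Z ↔ ∀ F ∈ coneIdeal Z, MvPolynomial.eval p.coords F = 0 := by
  rw [← coords_mem_cone, mem_cone_iff_of_isClosed hZ]

theorem subset_of_coneIdeal_le {Z W : Set (ProjSpace K n)} (hW : IsClosed W)
    (h : coneIdeal W ≤ coneIdeal Z) : Z ⊆ W := fun _ hp =>
  (mem_iff_of_isClosed hW).2 fun _ hF => mem_coneIdeal.1 (h hF) _ (coords_mem_cone.2 hp)

theorem coneIdeal_lt_of_ssubset {Z W : Set (ProjSpace K n)} (hZ : IsClosed Z)
    (h : Z ⊂ W) : coneIdeal W < coneIdeal Z :=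
  lt_of_le_not_ge (coneIdeal_anti h.1) fun hle => h.2 (subset_of_coneIdeal_le hZ hle)

theorem homogeneousComponent_mem_coneIdeal [Infinite K] {Z : Set (ProjSpace K n)}
    {F : MvPolynomial (Fin (n + 1)) K} (hF : F ∈ coneIdeal Z) (d : ℕ) :
    MvPolynomial.homogeneousComponent d F ∈ coneIdeal Z :=
  homogeneousComponent_mem_vanishingIdeal (fun t _ hv => smul_mem_cone t hv) hF d

instance noetherianSpace : NoetherianSpace (ProjSpace K n) := by
  refine ((noetherianSpace_TFAE (ProjSpace K n)).out 0 1).2 ?_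
  let f : Closeds (ProjSpace K n) → (Ideal (MvPolynomial (Fin (n + 1)) K))ᵒᵈ :=
    fun Z => OrderDual.toDual (coneIdeal (Z : Set (ProjSpace K n)))
  have hf : StrictMono f := fun Z W h =>
    coneIdeal_lt_of_ssubset Z.isClosed (SetLike.coe_ssubset_coe.2 h)
  exact hf.wellFoundedLT

/-- The ideal of an irreducible set is prime. -/
theorem isPrime_coneIdeal [Infinite K] {Z : Set (ProjSpace K n)} (hZ : IsIrreducible Z) :
    (coneIdeal Z).IsPrime := by
  -- the points on whose line through the origin `F` does not vanish identically
  let U : MvPolynomial (Fin (n + 1)) K → Set (ProjSpace K n) := fun F =>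
    ⋃ d, (zeroLocus {MvPolynomial.homogeneousComponent d F})ᶜ
  have hU : ∀ F, IsOpen (U F) := fun _ => isOpen_iUnion fun _ =>
    (isClosed_zeroLocus_singleton
      (MvPolynomial.homogeneousComponent_isHomogeneous _ _)).isOpen_compl
  have hUmem : ∀ F p, p ∈ U F ↔
      MvPolynomial.aeval (fun i => Polynomial.C (p.coords i) * Polynomial.X) F ≠ 0 := by
    intro F p
    simp only [U, Set.mem_iUnion, Set.mem_compl_iff, zeroLocus, Set.mem_singleton_iff,
      forall_eq, Set.mem_ofPred_eq, ← coeff_aeval_C_mul_X, ne_eq, Polynomial.ext_iff,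
      Polynomial.coeff_zero, not_forall]
  have hUZ : ∀ F, F ∉ coneIdeal Z → (Z ∩ U F).Nonempty := by
    intro F hF
    rw [mem_coneIdeal] at hF
    push Not at hF
    obtain ⟨v, hv, hFv⟩ := hF
    have key : ∀ (p : ProjSpace K n) (t : K), v = t • p.coords → p ∈ U F := by
      rintro p t rfl
      rw [hUmem]
      intro h0
      rw [← eval_aeval_C_mul_X, h0, Polynomial.eval_zero] at hFv
      exact hFv rfl
    by_cases hv0 : v = 0
    · obtain ⟨p, hp⟩ := hZ.nonempty
      exact ⟨p, hp, key p 0 (by simp [hv0])⟩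
    · obtain ⟨t, ht, h⟩ := exists_coords_ofCoords hv0
      exact ⟨_, hv hv0, key _ t⁻¹ (by rw [h, smul_smul, inv_mul_cancel₀ ht, one_smul])⟩
  refine ⟨?_, ?_⟩
  · rw [Ideal.ne_top_iff_one, mem_coneIdeal]
    intro h
    simpa using h 0 (zero_mem_cone Z)
  · intro F G hFG
    by_contra! hc
    obtain ⟨p, hpZ, hpF, hpG⟩ := hZ.2 _ _ (hU F) (hU G) (hUZ F hc.1) (hUZ G hc.2)
    rw [hUmem] at hpF hpG
    refine mul_ne_zero hpF hpG (Polynomial.funext fun t => ?_)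
    rw [← map_mul, eval_aeval_C_mul_X,
      mem_coneIdeal.1 hFG _ (smul_mem_cone t (coords_mem_cone.2 hpZ)), Polynomial.eval_zero]

theorem isIrreducible_of_isPrime_coneIdeal {Z : Set (ProjSpace K n)} (hne : Z.Nonempty)
    (hP : (coneIdeal Z).IsPrime) : IsIrreducible Z := by
  refine ⟨hne, isPreirreducible_iff_isClosed_union_isClosed.2 fun A B hA hB hAB => ?_⟩
  by_contra! hc
  have key : ∀ A : Set (ProjSpace K n), IsClosed A → ¬ Z ⊆ A → ∃ F ∈ coneIdeal A,
      F ∉ coneIdeal Z := by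
    intro A hA hZA
    by_contra! h
    exact hZA (subset_of_coneIdeal_le hA h)
  obtain ⟨F, hFA, hFZ⟩ := key A hA hc.1
  obtain ⟨G, hGB, hGZ⟩ := key B hB hc.2
  have : F * G ∈ coneIdeal Z := by
    rw [mem_coneIdeal]
    intro v hv
    by_cases hv0 : v = 0
    · rw [map_mul, hv0, mem_coneIdeal.1 hFA 0 (zero_mem_cone A), zero_mul]
    · rcases hAB (hv hv0) with h | h
      · rw [map_mul, mem_coneIdeal.1 hFA v fun _ => h, zero_mul]
      · rw [map_mul, mem_coneIdeal.1 hGB v fun _ => h, mul_zero]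
  exact (hP.mem_or_mem this).elim hFZ hGZ

/-- The closed subset of projective space swept out by a set of vectors. -/
def projClosure (D : Set (Fin (n + 1) → K)) : Set (ProjSpace K n) :=
  closure {p | p.coords ∈ D}

theorem subset_cone_projClosure {D : Set (Fin (n + 1) → K)}
    (hD : ∀ (t : K), ∀ v ∈ D, t • v ∈ D) : D ⊆ cone (projClosure D) := by
  intro v hv hv0
  refine subset_closure ?_
  obtain ⟨t, -, h⟩ := exists_coords_ofCoords hv0
  rw [Set.mem_ofPred_eq, h]
  exact hD t v hv

theorem coneIdeal_projClosure [Infinite K] {D : Set (Fin (n + 1) → K)}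
    (hD : ∀ (t : K), ∀ v ∈ D, t • v ∈ D) (hne : D.Nonempty) :
    coneIdeal (projClosure D) = MvPolynomial.vanishingIdeal K D := by
  apply le_antisymm
  · exact MvPolynomial.vanishingIdeal_anti_mono (subset_cone_projClosure hD)
  · intro F hF
    rw [mem_coneIdeal]
    intro v hv
    by_cases hv0 : v = 0
    · obtain ⟨w, hw⟩ := hne
      rw [hv0, ← zero_smul K w]
      exact mem_vanishingIdeal.1 hF _ (hD 0 w hw)
    · rw [eval_eq_sum_homogeneousComponent]
      refine Finset.sum_eq_zero fun d _ => ?_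
      have hd := MvPolynomial.homogeneousComponent_isHomogeneous d F
      have hsub : {p : ProjSpace K n | p.coords ∈ D} ⊆
          zeroLocus {MvPolynomial.homogeneousComponent d F} := by
        rintro p hp _ rfl
        exact mem_vanishingIdeal.1 (homogeneousComponent_mem_vanishingIdeal hD hF d) _ hp
      have := closure_minimal hsub (isClosed_zeroLocus_singleton hd) (hv hv0) _ rfl
      rwa [eval_coords_ofCoords_eq_zero_iff hd] at this

/-! ### Chains of irreducible closed subsets -/

theorem isIrreducible_preimage_coe {α : Type*} [TopologicalSpace α] {Z S : Set α}
    (hS : IsIrreducible S) (hSZ : S ⊆ Z) : IsIrreducible ((↑) ⁻¹' S : Set Z) := by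
  refine ⟨let ⟨x, hx⟩ := hS.nonempty; ⟨⟨x, hSZ hx⟩, hx⟩, ?_⟩
  rintro _ _ ⟨U, hU, rfl⟩ ⟨V, hV, rfl⟩ ⟨x, hxS, hxU⟩ ⟨y, hyS, hyV⟩
  obtain ⟨z, hzS, hz⟩ := hS.2 U V hU hV ⟨x, hxS, hxU⟩ ⟨y, hyS, hyV⟩
  exact ⟨⟨z, hSZ hzS⟩, hzS, hz⟩

/-- The dimension of a closed subspace is computed by chains of irreducible closed subsets of the
ambient space. -/
theorem natCast_le_topologicalKrullDim_iff {α : Type*} [TopologicalSpace α] {Z : Set α}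
    (hZ : IsClosed Z) {k : ℕ} :
    (k : WithBot ℕ∞) ≤ topologicalKrullDim Z ↔
      ∃ s : LTSeries (IrreducibleCloseds α), s.length = k ∧ (s.last : Set α) ⊆ Z := by
  rw [topologicalKrullDim, Order.le_krullDim_iff]
  constructor
  · rintro ⟨s, hs⟩
    refine ⟨s.map _ (IrreducibleCloseds.map_strictMono_of_isInducing IsInducing.subtypeVal),
      hs, ?_⟩
    rw [LTSeries.last_map, IrreducibleCloseds.coe_map]
    refine closure_minimal ?_ hZ
    rintro _ ⟨x, -, rfl⟩
    exact x.2
  · rintro ⟨s, hs, hsZ⟩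
    have hsub : ∀ i, (s i : Set α) ⊆ Z := fun i =>
      (SetLike.coe_subset_coe.2 (s.strictMono.monotone (Fin.le_last i))).trans hsZ
    let g : Fin (s.length + 1) → IrreducibleCloseds Z := fun i =>
      { carrier := (↑) ⁻¹' (s i : Set α)
        isIrreducible' := isIrreducible_preimage_coe (s i).isIrreducible (hsub i)
        isClosed' := (s i).isClosed.preimage continuous_subtype_val }
    have hg : StrictMono g := by
      intro i j hij
      have hlt : s i < s j := s.strictMono hij
      refine lt_of_le_not_ge (fun x hx => hlt.le hx) fun hle => hlt.not_ge ?_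
      intro x hx
      exact hle (show (⟨x, hsub j hx⟩ : Z) ∈ g j from hx)
    exact ⟨LTSeries.mk s.length g hg, hs⟩

theorem natCast_le_topologicalKrullDim_of_chain {α : Type*} [TopologicalSpace α] {Z : Set α}
    (hZ : IsClosed Z) {k : ℕ} (T : Fin (k + 1) → Set α) (hcl : ∀ i, IsClosed (T i))
    (hirr : ∀ i, IsIrreducible (T i)) (hT : ∀ i : Fin k, T i.castSucc ⊂ T i.succ)
    (hlast : T (Fin.last k) ⊆ Z) : (k : WithBot ℕ∞) ≤ topologicalKrullDim Z :=
  (natCast_le_topologicalKrullDim_iff hZ).2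
    ⟨LTSeries.mk k (fun i => ⟨T i, hirr i, hcl i⟩)
      (Fin.strictMono_iff_lt_succ.2 fun i => SetLike.coe_ssubset_coe.1 (hT i)), rfl, hlast⟩

/-! ### Linear forms and finiteness -/

/-- The linear functional `f` as a homogeneous polynomial of degree one. -/
noncomputable def linForm (f : Module.Dual K (Fin (n + 1) → K)) : MvPolynomial (Fin (n + 1)) K :=
  ∑ i, MvPolynomial.C (f (Pi.single i 1)) * MvPolynomial.X i

theorem isHomogeneous_linForm (f : Module.Dual K (Fin (n + 1) → K)) :
    (linForm f).IsHomogeneous 1 :=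
  MvPolynomial.IsHomogeneous.sum _ _ _ fun i _ => MvPolynomial.isHomogeneous_C_mul_X _ i

theorem dual_apply_eq_sum (f : Module.Dual K (Fin (n + 1) → K)) (v : Fin (n + 1) → K) :
    f v = ∑ i, f (Pi.single i 1) * v i := by
  conv_lhs => rw [pi_eq_sum_univ' v, map_sum]
  refine Finset.sum_congr rfl fun i _ => ?_
  rw [map_smul, smul_eq_mul, mul_comm]

@[simp]
theorem eval_linForm (f : Module.Dual K (Fin (n + 1) → K)) (v : Fin (n + 1) → K) :
    MvPolynomial.eval v (linForm f) = f v := by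
  simp [linForm, dual_apply_eq_sum f v]

/-- The linear forms `l` have no common zero on `Z`. -/
def NoCommonZero {k : ℕ} (l : Fin k → Module.Dual K (Fin (n + 1) → K)) (Z : Set (ProjSpace K n)) :
    Prop :=
  ∀ v ∈ cone Z, (∀ j, l j v = 0) → v = 0

theorem NoCommonZero.mono {k : ℕ} {l : Fin k → Module.Dual K (Fin (n + 1) → K)}
    {Z W : Set (ProjSpace K n)} (hl : NoCommonZero l W) (h : Z ⊆ W) : NoCommonZero l Z :=
  fun v hv => hl v (cone_mono h hv)

/-- The homogeneous coordinate ring of `Z`, that is the ring of polynomial functions on the affine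
cone over `Z`. -/
def CoordRing (Z : Set (ProjSpace K n)) : Type _ :=
  MvPolynomial (Fin (n + 1)) K ⧸ coneIdeal Z

namespace CoordRing

noncomputable instance (Z : Set (ProjSpace K n)) : CommRing (CoordRing Z) :=
  inferInstanceAs (CommRing (MvPolynomial (Fin (n + 1)) K ⧸ coneIdeal Z))

noncomputable instance (Z : Set (ProjSpace K n)) : Algebra K (CoordRing Z) :=
  inferInstanceAs (Algebra K (MvPolynomial (Fin (n + 1)) K ⧸ coneIdeal Z))

instance (Z : Set (ProjSpace K n)) : IsNoetherianRing (CoordRing Z) :=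
  inferInstanceAs (IsNoetherianRing (MvPolynomial (Fin (n + 1)) K ⧸ coneIdeal Z))

/-- The restriction of polynomials to the cone over `Z`. -/
noncomputable def mk (Z : Set (ProjSpace K n)) :
    MvPolynomial (Fin (n + 1)) K →ₐ[K] CoordRing Z :=
  Ideal.Quotient.mkₐ K (coneIdeal Z)

theorem mk_surjective (Z : Set (ProjSpace K n)) : Function.Surjective (mk Z) :=
  Ideal.Quotient.mk_surjective

theorem mk_eq_zero_iff {Z : Set (ProjSpace K n)} {F : MvPolynomial (Fin (n + 1)) K} :
    mk Z F = 0 ↔ F ∈ coneIdeal Z := Ideal.Quotient.eq_zero_iff_mem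

/-- Evaluation of functions on the cone at one of its points. -/
noncomputable def evalAt {Z : Set (ProjSpace K n)} {v : Fin (n + 1) → K} (hv : v ∈ cone Z) :
    CoordRing Z →ₐ[K] K :=
  Ideal.Quotient.liftₐ (coneIdeal Z) (MvPolynomial.aeval v) fun F hF => by
    rw [MvPolynomial.aeval_eq_eval]
    exact mem_coneIdeal.1 hF v hv

@[simp]
theorem evalAt_mk {Z : Set (ProjSpace K n)} {v : Fin (n + 1) → K} (hv : v ∈ cone Z)
    (F : MvPolynomial (Fin (n + 1)) K) : evalAt hv (mk Z F) = MvPolynomial.eval v F := by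
  rw [← MvPolynomial.aeval_eq_eval]
  rfl

theorem ext_evalAt {Z : Set (ProjSpace K n)} {a b : CoordRing Z}
    (h : ∀ v, ∀ hv : v ∈ cone Z, evalAt hv a = evalAt hv b) : a = b := by
  obtain ⟨F, rfl⟩ := mk_surjective Z a
  obtain ⟨G, rfl⟩ := mk_surjective Z b
  rw [← sub_eq_zero, ← map_sub, mk_eq_zero_iff, mem_coneIdeal]
  intro v hv
  have := h v hv
  rw [evalAt_mk, evalAt_mk] at this
  rw [map_sub, this, sub_self]

theorem isDomain [Infinite K] {Z : Set (ProjSpace K n)} (hZ : IsIrreducible Z) :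
    IsDomain (CoordRing Z) :=
  (Ideal.Quotient.isDomain_iff_prime (coneIdeal Z)).2 (isPrime_coneIdeal hZ)

end CoordRing

/-- The homomorphism from the polynomial ring in `k` variables to the homogeneous coordinate ring
of `Z` which sends the variables to the linear forms `l`. -/
noncomputable def formsHom {k : ℕ} (l : Fin k → Module.Dual K (Fin (n + 1) → K))
    (Z : Set (ProjSpace K n)) : MvPolynomial (Fin k) K →ₐ[K] CoordRing Z :=
  (CoordRing.mk Z).comp (MvPolynomial.aeval fun j => linForm (l j))

theorem formsHom_apply {k : ℕ} (l : Fin k → Module.Dual K (Fin (n + 1) → K))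
    (Z : Set (ProjSpace K n)) (G : MvPolynomial (Fin k) K) :
    formsHom l Z G = CoordRing.mk Z (MvPolynomial.aeval (fun j => linForm (l j)) G) := rfl

theorem homogeneousComponent_succ_mul {σ : Type*} (F G : MvPolynomial σ K)
    (hG : G.IsHomogeneous 1) (d : ℕ) :
    MvPolynomial.homogeneousComponent (d + 1) (F * G) =
      MvPolynomial.homogeneousComponent d F * G := by
  have key : ∀ i, MvPolynomial.homogeneousComponent (d + 1)
      (MvPolynomial.homogeneousComponent i F * G) =
      if d = i then MvPolynomial.homogeneousComponent i F * G else 0 := by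
    intro i
    rw [MvPolynomial.homogeneousComponent_of_mem (n := i + 1)]
    · simp
    · exact (MvPolynomial.homogeneousComponent_isHomogeneous i F).mul hG
  conv_lhs => rw [← MvPolynomial.sum_homogeneousComponent F, Finset.sum_mul, map_sum]
  simp only [key]
  rw [Finset.sum_ite_eq]
  split_ifs with h
  · rfl
  · rw [MvPolynomial.homogeneousComponent_eq_zero, zero_mul]
    simpa using h

/-- By the Nullstellensatz, if the forms `l` have no common zero on `Z` then all forms of large
degree lie in the ideal generated by `l` and the ideal of `Z`. -/
theorem exists_pow_idealOfVars_le [IsAlgClosed K] {k : ℕ}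
    {l : Fin k → Module.Dual K (Fin (n + 1) → K)} {Z : Set (ProjSpace K n)} (hZ : IsClosed Z)
    (hl : NoCommonZero l Z) :
    ∃ D : ℕ, MvPolynomial.idealOfVars (Fin (n + 1)) K ^ D ≤
      coneIdeal Z ⊔ Ideal.span (Set.range fun j => linForm (l j)) := by
  refine Ideal.exists_pow_le_of_le_radical_of_fg ?_ (MvPolynomial.idealOfVars_fg _ _)
  rw [← MvPolynomial.vanishingIdeal_zeroLocus_eq_radical (K := K), Ideal.span_le]
  rintro _ ⟨i, rfl⟩
  refine mem_vanishingIdeal.2 fun v hv => ?_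
  simp only [MvPolynomial.mem_zeroLocus_iff, MvPolynomial.aeval_eq_eval] at hv
  have hvZ : v ∈ cone Z :=
    (mem_cone_iff_of_isClosed hZ).2 fun F hF => hv F (Ideal.mem_sup_left hF)
  have : v = 0 := hl v hvZ fun j => by
    rw [← eval_linForm]
    exact hv _ (Ideal.mem_sup_right (Ideal.subset_span ⟨j, rfl⟩))
  simp [this]

/-- If the forms `l` have no common zero on `Z` then the homogeneous coordinate ring of `Z` is
finite over the polynomial ring in these forms. -/
theorem formsHom_finite [IsAlgClosed K] {k : ℕ}
    {l : Fin k → Module.Dual K (Fin (n + 1) → K)} {Z : Set (ProjSpace K n)} (hZ : IsClosed Z)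
    (hl : NoCommonZero l Z) : (formsHom l Z).toRingHom.Finite := by
  obtain ⟨D, hD⟩ := exists_pow_idealOfVars_le hZ hl
  let : Algebra (MvPolynomial (Fin k) K) (CoordRing Z) :=
    (formsHom l Z).toRingHom.toAlgebra
  have hsmul : ∀ (G : MvPolynomial (Fin k) K) (a : CoordRing Z),
      G • a = formsHom l Z G * a := fun _ _ => rfl
  choose g hg using fun d : ℕ =>
    (MvPolynomial.homogeneousSubmodule_fg (R := K) (σ := Fin (n + 1)) d)
  -- forms of degree at most `D` generate the coordinate ring as a module
  let T : Set (CoordRing Z) :=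
    ⋃ d ∈ Finset.range (D + 1), CoordRing.mk Z '' (g d)
  have hT : T.Finite := Set.Finite.biUnion (Finset.finite_toSet _) fun d _ =>
    (Finset.finite_toSet _).image _
  have hlow : ∀ d ≤ D, ∀ F : MvPolynomial (Fin (n + 1)) K, F.IsHomogeneous d →
      CoordRing.mk Z F ∈ Submodule.span (MvPolynomial (Fin k) K) T := by
    intro d hd F hF
    have hF' : F ∈ Submodule.span K (g d : Set (MvPolynomial (Fin (n + 1)) K)) := by
      rw [hg]
      exact hF
    induction hF' using Submodule.span_induction with
    | mem x hx =>
      refine Submodule.subset_span (Set.mem_biUnion (x := d) ?_ ⟨x, hx, rfl⟩)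
      exact Finset.mem_coe.2 (Finset.mem_range.2 (Nat.lt_succ_of_le hd))
    | zero => simp
    | add x y hx hy ihx ihy =>
      rw [map_add]
      rw [hg] at hx hy
      exact add_mem (ihx hx) (ihy hy)
    | smul c x hx ih =>
      have : CoordRing.mk Z (c • x) =
          (MvPolynomial.C c : MvPolynomial (Fin k) K) • CoordRing.mk Z x := by
        rw [hsmul, map_smul, ← MvPolynomial.algebraMap_eq, AlgHom.commutes, Algebra.smul_def]
      rw [this]
      rw [hg] at hx
      exact Submodule.smul_mem _ _ (ih hx)
  have hall : ∀ d, ∀ F : MvPolynomial (Fin (n + 1)) K, F.IsHomogeneous d →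
      CoordRing.mk Z F ∈ Submodule.span (MvPolynomial (Fin k) K) T := by
    intro d
    induction d with
    | zero => exact hlow 0 (Nat.zero_le _)
    | succ d ih =>
      intro F hF
      rcases le_or_gt (d + 1) D with h | h
      · exact hlow _ h F hF
      have hFD : F ∈ MvPolynomial.idealOfVars (Fin (n + 1)) K ^ D := by
        rw [MvPolynomial.mem_pow_idealOfVars_iff]
        intro x hx
        have := hF (MvPolynomial.mem_support_iff.1 hx)
        have : x.degree = d + 1 := by rw [Finsupp.degree_eq_weight_one]; exact this
        omega
      obtain ⟨p, hp, q, hq, hpq⟩ := Submodule.mem_sup.1 (hD hFD)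
      obtain ⟨c, rfl⟩ := Ideal.mem_span_range_iff_exists_fun.1 hq
      have hF' : F = MvPolynomial.homogeneousComponent (d + 1) p +
          ∑ j, MvPolynomial.homogeneousComponent d (c j) * linForm (l j) := by
        rw [← MvPolynomial.homogeneousComponent_eq_self hF, ← hpq, map_add, map_sum]
        simp only [homogeneousComponent_succ_mul _ _ (isHomogeneous_linForm _)]
      rw [hF', map_add, CoordRing.mk_eq_zero_iff.2 (homogeneousComponent_mem_coneIdeal hp _),
        zero_add, map_sum]
      refine sum_mem fun j _ => ?_
      have : CoordRing.mk Z
          (MvPolynomial.homogeneousComponent d (c j) * linForm (l j)) =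
          (MvPolynomial.X j : MvPolynomial (Fin k) K) •
            CoordRing.mk Z (MvPolynomial.homogeneousComponent d (c j)) := by
        rw [hsmul, formsHom_apply, MvPolynomial.aeval_X, map_mul, mul_comm]
      rw [this]
      exact Submodule.smul_mem _ _ (ih _ (MvPolynomial.homogeneousComponent_isHomogeneous _ _))
  refine Module.finite_def.2 (Submodule.fg_def.2 ⟨T, hT, eq_top_iff.2 fun a _ => ?_⟩)
  obtain ⟨F, rfl⟩ := CoordRing.mk_surjective Z a
  rw [← MvPolynomial.sum_homogeneousComponent F, map_sum]
  exact sum_mem fun d _ => hall d _ (MvPolynomial.homogeneousComponent_isHomogeneous _ _)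

/-! ### Transcendence degree along chains of primes -/

section Trdeg

variable {A : Type*} [CommRing A] [Algebra K A]

/-- If `P < Q` are primes, then elements which are algebraically independent modulo `Q` together
with an element of `Q` outside of `P` are algebraically independent modulo `P`. -/
theorem algebraicIndependent_option_of_lt {P Q : Ideal A} [P.IsPrime] (hPQ : P ≤ Q) {f : A}
    (hfQ : f ∈ Q) (hfP : f ∉ P) {ι : Type*} {x : ι → A}
    (hx : AlgebraicIndependent K fun i => Ideal.Quotient.mkₐ K Q (x i)) :
    AlgebraicIndependent K
      fun o : Option ι => o.elim (Ideal.Quotient.mkₐ K P f) fun i => Ideal.Quotient.mkₐ K P (x i) := by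
  let φ : A ⧸ P →ₐ[K] A ⧸ Q := Ideal.Quotient.factorₐ K hPQ
  have hφ : ∀ a, φ (Ideal.Quotient.mkₐ K P a) = Ideal.Quotient.mkₐ K Q a := fun a => rfl
  have hx' : AlgebraicIndependent K fun i => Ideal.Quotient.mkₐ K P (x i) :=
    AlgebraicIndependent.of_comp φ hx
  rw [hx'.option_iff_transcendental]
  intro halg
  have hf0 : Ideal.Quotient.mkₐ K P f ∈ nonZeroDivisors (A ⧸ P) :=
    mem_nonZeroDivisors_of_ne_zero fun h => hfP (Ideal.Quotient.eq_zero_iff_mem.1 h)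
  obtain ⟨q, hq0, hq⟩ := halg.exists_nonzero_coeff_and_aeval_eq_zero hf0
  obtain ⟨G, hG⟩ := (Algebra.adjoin_range_eq_range_aeval K
    fun i => Ideal.Quotient.mkₐ K P (x i)).le (q.coeff 0).2
  have hfQ0 : Ideal.Quotient.mkₐ K Q f = 0 := Ideal.Quotient.eq_zero_iff_mem.2 hfQ
  have h0 : φ (q.coeff 0 : _) = 0 := by
    have := congrArg φ hq
    rw [← Polynomial.X_mul_divX_add q, map_add, map_mul, Polynomial.aeval_X, Polynomial.aeval_C,
      map_add, map_mul, hφ, hfQ0, zero_mul, zero_add, map_zero] at this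
    exact this
  have hGP : MvPolynomial.aeval (fun i => Ideal.Quotient.mkₐ K P (x i)) G =
      ((q.coeff 0 : _) : A ⧸ P) := hG
  have hG0 : MvPolynomial.aeval (fun i => Ideal.Quotient.mkₐ K Q (x i)) G = 0 := by
    rw [← hGP, MvPolynomial.comp_aeval_apply] at h0
    exact h0
  have : G = 0 := hx.eq_zero_of_aeval_eq_zero G hG0
  rw [this, map_zero] at hGP
  exact hq0 (Subtype.ext hGP.symm)

theorem trdeg_quotient_add_one_le {P Q : Ideal A} [P.IsPrime] [Q.IsPrime] (hPQ : P < Q) :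
    Algebra.trdeg K (A ⧸ Q) + 1 ≤ Algebra.trdeg K (A ⧸ P) := by
  obtain ⟨f, hfQ, hfP⟩ := SetLike.exists_of_lt hPQ
  obtain ⟨ι, x, hx⟩ := exists_isTranscendenceBasis' K (A ⧸ Q)
  choose y hy using fun i => Ideal.Quotient.mk_surjective (x i)
  have hxy : (fun i => Ideal.Quotient.mkₐ K Q (y i)) = x := funext hy
  have := (algebraicIndependent_option_of_lt hPQ.le hfQ hfP
    (hxy ▸ hx.1 : AlgebraicIndependent K fun i => Ideal.Quotient.mkₐ K Q (y i)))
  have := this.cardinalMk_le_trdeg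
  rwa [Cardinal.mk_option, hx.cardinalMk_eq_trdeg] at this

/-- A domain which is integral over the image of a polynomial ring in `ι` has transcendence degree
at most the cardinality of `ι`. -/
theorem trdeg_le_card_of_isIntegral [IsDomain A] {ι : Type*} [Fintype ι] (x : ι → A)
    (h : ∀ a : A, IsIntegral (Algebra.adjoin K (Set.range x)) a) :
    Algebra.trdeg K A ≤ Fintype.card ι := by
  have : Algebra.IsIntegral (Algebra.adjoin K (Set.range x)) A := ⟨h⟩
  have hle := Algebra.IsAlgebraic.trdeg_le_cardinalMk K (Set.range x)
  refine hle.trans ?_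
  classical
  rw [Cardinal.mk_fintype, Nat.cast_le]
  exact Fintype.card_range_le x

theorem algHom_mem_of_forall_X_mem {ι : Type*} (ψ : MvPolynomial ι K →ₐ[K] A) (C : Subalgebra K A)
    (h : ∀ j, ψ (MvPolynomial.X j) ∈ C) (G : MvPolynomial ι K) : ψ G ∈ C := by
  have : ψ G ∈ Algebra.adjoin K (Set.range fun j => ψ (MvPolynomial.X j)) := by
    rw [Algebra.adjoin_range_eq_range_aeval]
    exact ⟨G, (congrArg (fun ψ : MvPolynomial ι K →ₐ[K] A => ψ G)
      (MvPolynomial.aeval_unique ψ)).symm⟩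
  exact Algebra.adjoin_le (by rintro _ ⟨j, rfl⟩; exact h j) this

theorem isIntegral_map_of_isIntegralElem {B : Type*} [CommRing B] [Algebra K B] {ι : Type*}
    {φ : MvPolynomial ι K →ₐ[K] A} {a : A} (ha : φ.toRingHom.IsIntegralElem a) (g : A →ₐ[K] B)
    (C : Subalgebra K B) (h : ∀ j, g (φ (MvPolynomial.X j)) ∈ C) : IsIntegral C (g a) := by
  obtain ⟨p, hp, hpa⟩ := ha
  have hmem := algHom_mem_of_forall_X_mem (g.comp φ) C h
  refine ⟨p.map ((g.comp φ).codRestrict _ hmem).toRingHom, hp.map _, ?_⟩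
  rw [Polynomial.eval₂_map]
  have := congrArg g.toRingHom hpa
  rw [Polynomial.hom_eval₂, map_zero] at this
  exact this

theorem trdeg_le_of_finite [IsDomain A] {k : ℕ} (φ : MvPolynomial (Fin k) K →ₐ[K] A)
    (hφ : φ.toRingHom.IsIntegral) : Algebra.trdeg K A ≤ k := by
  have := trdeg_le_card_of_isIntegral (K := K) (fun j => φ (MvPolynomial.X j)) fun a =>
    isIntegral_map_of_isIntegralElem (hφ a) (AlgHom.id K A) _ fun j => Algebra.subset_adjoin ⟨j, rfl⟩
  simpa using this

end Trdeg

/-! ### Dimension and linear forms without common zeros -/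

/-- The transcendence degrees of the coordinate rings of irreducible subsets bound the
dimension. -/
theorem lt_of_trdeg_coordRing_le [IsAlgClosed K] {Z : Set (ProjSpace K n)} (hZ : IsClosed Z) {k : ℕ}
    (h : ∀ T : Set (ProjSpace K n), IsClosed T → IsIrreducible T → T ⊆ Z →
      Algebra.trdeg K (CoordRing T) ≤ k) :
    topologicalKrullDim Z < k := by
  rw [← not_le, natCast_le_topologicalKrullDim_iff hZ]
  rintro ⟨s, hs, hsZ⟩
  have key : ∀ i : Fin (s.length + 1), ((i : ℕ) + 1 : Cardinal) ≤
      Algebra.trdeg K (CoordRing (s i : Set (ProjSpace K n))) := by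
    intro i
    have hP := isPrime_coneIdeal (s i).isIrreducible
    induction i using Fin.induction with
    | zero =>
      -- start with the ideal of the origin, whose quotient is `K`
      have hlt : coneIdeal (s 0 : Set (ProjSpace K n)) <
          MvPolynomial.vanishingIdeal K {(0 : Fin (n + 1) → K)} := by
        refine lt_of_le_of_ne (MvPolynomial.vanishingIdeal_anti_mono
          (Set.singleton_subset_iff.2 (zero_mem_cone _))) fun heq => ?_
        obtain ⟨p, hp⟩ := (s 0).isIrreducible.nonempty
        obtain ⟨i, hi⟩ := exists_coord_ne_zero p.coords_ne_zero
        have : MvPolynomial.X i ∈ coneIdeal (s 0 : Set (ProjSpace K n)) := by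
          rw [heq, mem_vanishingIdeal]
          rintro _ rfl
          simp
        exact hi (by simpa using mem_coneIdeal.1 this _ (coords_mem_cone.2 hp))
      refine le_trans ?_ (trdeg_quotient_add_one_le (K := K) hlt)
      simp
    | succ i ih =>
      have hP' := isPrime_coneIdeal (s i.castSucc).isIrreducible
      have hlt : coneIdeal (s i.succ : Set (ProjSpace K n)) < coneIdeal (s i.castSucc) :=
        coneIdeal_lt_of_ssubset (s i.castSucc).isClosed
          (SetLike.coe_ssubset_coe.2 (s.strictMono i.castSucc_lt_succ))
      refine le_trans ?_ (trdeg_quotient_add_one_le (K := K) hlt)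
      have := ih hP'
      simp only [Fin.val_castSucc] at this
      rw [Fin.val_succ, Nat.cast_add, Nat.cast_one]
      gcongr
      exact this
  have h1 := key (Fin.last _)
  have h2 := h _ s.last.isClosed s.last.isIrreducible hsZ
  have h3 := h1.trans h2
  rw [Fin.val_last, hs] at h3
  exact absurd (by exact_mod_cast h3 : k + 1 ≤ k) (by omega)

/-- If `k` linear forms have no common zero on `Z`, then `dim Z < k`. -/
theorem NoCommonZero.dim_lt [IsAlgClosed K] {k : ℕ}
    {l : Fin k → Module.Dual K (Fin (n + 1) → K)} {Z : Set (ProjSpace K n)} (hZ : IsClosed Z)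
    (hl : NoCommonZero l Z) : topologicalKrullDim Z < k := by
  refine lt_of_trdeg_coordRing_le hZ fun T hT hTi hTZ => ?_
  have := CoordRing.isDomain hTi
  exact trdeg_le_of_finite (formsHom l T) (formsHom_finite hT (hl.mono hTZ)).to_isIntegral

theorem isClosed_linearZeros (f : Module.Dual K (Fin (n + 1) → K)) :
    IsClosed {p : ProjSpace K n | f p.coords = 0} := by
  convert isClosed_zeroLocus_singleton (isHomogeneous_linForm f) using 1
  ext p
  simp [zeroLocus]

/-- A linear form which vanishes at none of finitely many points. -/
theorem exists_dual_forall_ne_zero [Infinite K] {ι : Type*} [Finite ι]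
    (v : ι → Fin (n + 1) → K) (hv : ∀ i, v i ≠ 0) :
    ∃ f : Module.Dual K (Fin (n + 1) → K), ∀ i, f (v i) ≠ 0 := by
  by_contra! hc
  obtain ⟨i, hi⟩ := Subspace.exists_eq_top_of_iUnion_eq_univ
    (p := fun i => LinearMap.ker (Module.Dual.eval K (Fin (n + 1) → K) (v i)))
    (Set.eq_univ_of_forall fun f => by
      obtain ⟨i, hi⟩ := hc f
      exact Set.mem_iUnion.2 ⟨i, hi⟩)
  refine hv i ((Module.forall_dual_apply_eq_zero_iff K (v i)).1 fun f => ?_)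
  have : f ∈ LinearMap.ker (Module.Dual.eval K (Fin (n + 1) → K) (v i)) := hi ▸ Submodule.mem_top
  exact this

/-- If `dim Z < k`, then there are `k` linear forms without common zeros on `Z`: a form which does
not vanish identically on any component of `Z` cuts out a subset of smaller dimension. -/
theorem exists_noCommonZero [IsAlgClosed K] {k : ℕ} {Z : Set (ProjSpace K n)} (hZ : IsClosed Z)
    (h : topologicalKrullDim Z < k) :
    ∃ l : Fin k → Module.Dual K (Fin (n + 1) → K), NoCommonZero l Z := by
  have := IsAlgClosed.instInfinite (K := K)
  induction k generalizing Z with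
  | zero =>
    refine ⟨Fin.elim0, fun v hv _ => ?_⟩
    by_contra hv0
    have : IsIrreducible (closure {ofCoords v hv0}) := isIrreducible_singleton.closure
    refine h.not_ge ((natCast_le_topologicalKrullDim_iff hZ).2
      ⟨RelSeries.singleton _ ⟨_, this, isClosed_closure⟩, rfl, ?_⟩)
    exact closure_minimal (Set.singleton_subset_iff.2 (hv hv0)) hZ
  | succ k ih =>
    obtain ⟨S, hSfin, hScl, hSirr, rfl⟩ :=
      NoetherianSpace.exists_finite_set_isClosed_irreducible hZ
    choose P hP using fun T : S => (hSirr T T.2).nonempty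
    have := hSfin.to_subtype
    obtain ⟨f, hf⟩ := exists_dual_forall_ne_zero (fun T : S => (P T).coords)
      fun T => coords_ne_zero _
    have hZ' := hZ.inter (isClosed_linearZeros f)
    obtain ⟨l, hl⟩ := ih hZ' (by
      rw [← not_le, natCast_le_topologicalKrullDim_iff hZ']
      rintro ⟨s, hs, hsZ⟩
      obtain ⟨T, hTS, hT⟩ := isIrreducible_iff_sUnion_isClosed.1 s.last.isIrreducible
        hSfin.toFinset (by simpa using hScl)
        (by rw [hSfin.coe_toFinset]; exact hsZ.trans Set.inter_subset_left)
      rw [hSfin.mem_toFinset] at hTS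
      have hlt : s.last < ⟨T, hSirr T hTS, hScl T hTS⟩ :=
        SetLike.coe_ssubset_coe.1 ⟨hT, fun hle => hf ⟨T, hTS⟩ (hsZ (hle (hP ⟨T, hTS⟩))).2⟩
      refine h.not_ge ((natCast_le_topologicalKrullDim_iff hZ).2
        ⟨s.snoc _ hlt, by simp [hs], ?_⟩)
      rw [RelSeries.last_snoc]
      exact Set.subset_sUnion_of_mem hTS)
    refine ⟨Fin.cons f l, fun v hv hv0 => hl v (fun h0 => ⟨hv h0, ?_⟩) fun j => ?_⟩
    · obtain ⟨t, -, ht⟩ := exists_coords_ofCoords h0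
      have := hv0 0
      rw [Fin.cons_zero] at this
      rw [Set.mem_ofPred_eq, ht, map_smul, this, smul_zero]
    · simpa using hv0 j.succ

/-- A linear subspace contained in a set of dimension less than `k` has projective dimension less
than `k`. -/
theorem finrank_le_of_subset_cone [IsAlgClosed K] {k : ℕ} {Z : Set (ProjSpace K n)}
    (hZ : IsClosed Z) (h : topologicalKrullDim Z < k) (W : Submodule K (Fin (n + 1) → K))
    (hW : (W : Set (Fin (n + 1) → K)) ⊆ cone Z) : Module.finrank K W ≤ k := by
  obtain ⟨l, hl⟩ := exists_noCommonZero hZ h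
  have hinj : Function.Injective ((LinearMap.pi l).domRestrict W) := by
    rw [injective_iff_map_eq_zero]
    intro w hw
    exact Subtype.ext (hl w (hW w.2) fun j => congrFun hw j)
  simpa using LinearMap.finrank_le_finrank_of_injective hinj

/-! ### Products of irreducible affine sets -/

section Product

variable {σ τ : Type*}

/-- The product of `V ⊆ K ^ σ` and `W ⊆ K ^ τ` as a subset of `K ^ (σ ⊕ τ)`. -/
def prodSet (V : Set (σ → K)) (W : Set (τ → K)) : Set (σ ⊕ τ → K) :=
  {u | u ∘ Sum.inl ∈ V ∧ u ∘ Sum.inr ∈ W}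

theorem eval_aeval_comp {ι : Type*} (g : σ → MvPolynomial ι K) (F : MvPolynomial σ K) (v : ι → K) :
    MvPolynomial.eval v (MvPolynomial.aeval g F) =
      MvPolynomial.eval (fun i => MvPolynomial.eval v (g i)) F := by
  rw [← MvPolynomial.aeval_eq_eval, ← MvPolynomial.aeval_eq_eval]
  exact MvPolynomial.comp_aeval_apply g (MvPolynomial.aeval v) F

theorem nonempty_of_isPrime_vanishingIdeal {V : Set (σ → K)}
    (hV : (MvPolynomial.vanishingIdeal K V).IsPrime) : V.Nonempty :=
  Set.nonempty_iff_ne_empty.2 fun h => hV.ne_top (h ▸ MvPolynomial.vanishingIdeal_empty)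

/-- A product of affine sets with prime vanishing ideals has a prime vanishing ideal. -/
theorem isPrime_vanishingIdeal_prodSet {V : Set (σ → K)} {W : Set (τ → K)}
    (hV : (MvPolynomial.vanishingIdeal K V).IsPrime)
    (hW : (MvPolynomial.vanishingIdeal K W).IsPrime) :
    (MvPolynomial.vanishingIdeal K (prodSet V W)).IsPrime := by
  -- the two partial evaluations of a polynomial on the product
  let L : (σ → K) → MvPolynomial (σ ⊕ τ) K → MvPolynomial τ K := fun v F =>
    MvPolynomial.aeval (Sum.elim (fun i => MvPolynomial.C (v i)) MvPolynomial.X) F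
  let R : (τ → K) → MvPolynomial (σ ⊕ τ) K → MvPolynomial σ K := fun w F =>
    MvPolynomial.aeval (Sum.elim MvPolynomial.X (fun i => MvPolynomial.C (w i))) F
  have hL : ∀ v w F, MvPolynomial.eval w (L v F) = MvPolynomial.eval (Sum.elim v w) F := by
    intro v w F
    rw [eval_aeval_comp]
    congr 2
    ext (i | i) <;> simp
  have hR : ∀ v w F, MvPolynomial.eval v (R w F) = MvPolynomial.eval (Sum.elim v w) F := by
    intro v w F
    rw [eval_aeval_comp]
    congr 2
    ext (i | i) <;> simp
  have hex : ∀ F ∉ MvPolynomial.vanishingIdeal K (prodSet V W), ∃ w ∈ W,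
      R w F ∉ MvPolynomial.vanishingIdeal K V := by
    intro F hF
    rw [mem_vanishingIdeal] at hF
    push Not at hF
    obtain ⟨u, ⟨hu1, hu2⟩, hFu⟩ := hF
    refine ⟨_, hu2, fun h => hFu ?_⟩
    have := mem_vanishingIdeal.1 h _ hu1
    rwa [hR, Sum.elim_comp_inl_inr] at this
  refine ⟨?_, ?_⟩
  · obtain ⟨v, hv⟩ := nonempty_of_isPrime_vanishingIdeal hV
    obtain ⟨w, hw⟩ := nonempty_of_isPrime_vanishingIdeal hW
    rw [Ideal.ne_top_iff_one, mem_vanishingIdeal]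
    intro h
    simpa using h (Sum.elim v w) ⟨by simpa using hv, by simpa using hw⟩
  · intro F G hFG
    by_contra! hc
    obtain ⟨w₁, hw₁, h₁⟩ := hex F hc.1
    obtain ⟨w₂, hw₂, h₂⟩ := hex G hc.2
    have h₃ : R w₁ F * R w₂ G ∉ MvPolynomial.vanishingIdeal K V :=
      fun h => (hV.mem_or_mem h).elim h₁ h₂
    rw [mem_vanishingIdeal] at h₃
    push Not at h₃
    obtain ⟨v, hv, hFGv⟩ := h₃
    rw [map_mul, hR, hR] at hFGv
    have h₄ : L v F * L v G ∈ MvPolynomial.vanishingIdeal K W := by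
      rw [mem_vanishingIdeal]
      intro w hw
      rw [map_mul, hL, hL, ← map_mul]
      exact mem_vanishingIdeal.1 hFG _ ⟨by simpa using hv, by simpa using hw⟩
    rcases hW.mem_or_mem h₄ with h | h
    · have := mem_vanishingIdeal.1 h w₁ hw₁
      rw [hL] at this
      exact left_ne_zero_of_mul hFGv this
    · have := mem_vanishingIdeal.1 h w₂ hw₂
      rw [hL] at this
      exact right_ne_zero_of_mul hFGv this

/-- The substitution `F(x) ↦ F(x + y)`. -/
noncomputable def addHom (σ : Type*) (K : Type*) [Field K] :
    MvPolynomial σ K →ₐ[K] MvPolynomial (σ ⊕ σ) K :=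
  MvPolynomial.aeval fun i => MvPolynomial.X (Sum.inl i) + MvPolynomial.X (Sum.inr i)

theorem eval_addHom (F : MvPolynomial σ K) (u : σ ⊕ σ → K) :
    MvPolynomial.eval u (addHom σ K F) = MvPolynomial.eval (u ∘ Sum.inl + u ∘ Sum.inr) F := by
  rw [addHom, eval_aeval_comp]
  congr 2
  ext i
  simp

theorem comap_addHom_vanishingIdeal (V W : Set (σ → K)) :
    (MvPolynomial.vanishingIdeal K (prodSet V W)).comap (addHom σ K) =
      MvPolynomial.vanishingIdeal K (V + W) := by
  ext F
  rw [Ideal.mem_comap, mem_vanishingIdeal, mem_vanishingIdeal]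
  constructor
  · rintro h _ ⟨v, hv, w, hw, rfl⟩
    have := h (Sum.elim v w) ⟨by simpa using hv, by simpa using hw⟩
    rwa [eval_addHom, Sum.elim_comp_inl, Sum.elim_comp_inr] at this
  · rintro h u ⟨h1, h2⟩
    rw [eval_addHom]
    exact h _ (Set.add_mem_add h1 h2)

end Product

/-! ### Joins -/

/-- The join of `X` and `Y`: the closure of the union of the lines joining a point of `X` with a
point of `Y`. -/
def join (X Y : Set (ProjSpace K n)) : Set (ProjSpace K n) :=
  projClosure (cone X + cone Y)

theorem smul_mem_cone_add {X Y : Set (ProjSpace K n)} (t : K) :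
    ∀ v ∈ cone X + cone Y, t • v ∈ cone X + cone Y := by
  rintro _ ⟨v, hv, w, hw, rfl⟩
  exact ⟨t • v, smul_mem_cone t hv, t • w, smul_mem_cone t hw, (smul_add t v w).symm⟩

theorem isClosed_join (X Y : Set (ProjSpace K n)) : IsClosed (join X Y) := isClosed_closure

theorem add_mem_cone_join {X Y : Set (ProjSpace K n)} {v w : Fin (n + 1) → K} (hv : v ∈ cone X)
    (hw : w ∈ cone Y) : v + w ∈ cone (join X Y) :=
  subset_cone_projClosure (fun t => smul_mem_cone_add t) (Set.add_mem_add hv hw)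

theorem subset_join_left (X Y : Set (ProjSpace K n)) : X ⊆ join X Y :=
  subset_of_cone_subset fun v hv => by
    simpa using add_mem_cone_join hv (zero_mem_cone Y)

theorem subset_join_right (X Y : Set (ProjSpace K n)) : Y ⊆ join X Y :=
  subset_of_cone_subset fun v hv => by
    simpa using add_mem_cone_join (zero_mem_cone X) hv

theorem join_mono {X Y X' Y' : Set (ProjSpace K n)} (hX : X ⊆ X') (hY : Y ⊆ Y') :
    join X Y ⊆ join X' Y' :=
  closure_mono fun _ hp => Set.add_subset_add (cone_mono hX) (cone_mono hY) hp

theorem coneIdeal_join [Infinite K] (X Y : Set (ProjSpace K n)) :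
    coneIdeal (join X Y) = MvPolynomial.vanishingIdeal K (cone X + cone Y) :=
  coneIdeal_projClosure (fun t => smul_mem_cone_add t)
    ⟨0 + 0, Set.add_mem_add (zero_mem_cone X) (zero_mem_cone Y)⟩

/-- The join of irreducible sets is irreducible, as the closure of an image of the product of
their cones. -/
theorem isIrreducible_join [Infinite K] {X Y : Set (ProjSpace K n)} (hX : IsIrreducible X)
    (hY : IsIrreducible Y) : IsIrreducible (join X Y) := by
  refine isIrreducible_of_isPrime_coneIdeal (hX.nonempty.mono (subset_join_left X Y)) ?_
  rw [coneIdeal_join, ← comap_addHom_vanishingIdeal]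
  have := isPrime_vanishingIdeal_prodSet (isPrime_coneIdeal hX) (isPrime_coneIdeal hY)
  exact Ideal.comap_isPrime _ _

/-- The join of a point `p` and a set is a cone with vertex `p`. -/
theorem smul_add_mem_cone_join_singleton [Infinite K] {p : ProjSpace K n} {X : Set (ProjSpace K n)}
    {z : Fin (n + 1) → K} (hz : z ∈ cone (join {p} X)) (t : K) :
    t • p.coords + z ∈ cone (join {p} X) := by
  have hcl := isClosed_join {p} X
  rw [mem_cone_iff_of_isClosed hcl] at hz ⊢
  intro F hF
  let G : MvPolynomial (Fin (n + 1)) K :=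
    MvPolynomial.aeval (fun i => MvPolynomial.C (t * p.coords i) + MvPolynomial.X i) F
  have hG : ∀ v, MvPolynomial.eval v G = MvPolynomial.eval (t • p.coords + v) F := by
    intro v
    rw [eval_aeval_comp]
    congr 2
    ext i
    simp
  rw [← hG]
  refine hz G ?_
  rw [coneIdeal_join, mem_vanishingIdeal] at hF ⊢
  rintro _ ⟨v, hv, w, hw, rfl⟩
  rw [cone_singleton] at hv
  obtain ⟨s, rfl⟩ := hv
  rw [hG]
  refine hF _ ⟨(t + s) • p.coords, ?_, w, hw, by simp only [add_smul, add_assoc]⟩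
  rw [cone_singleton]
  exact ⟨_, rfl⟩

theorem secantVariety_two (X : Set (ProjSpace K n)) (hX : X.Nonempty) :
    secantVariety 2 X = join X X := by
  unfold secantVariety join projClosure
  congr 1
  ext q
  simp only [Set.mem_ofPred_eq]
  have hline : ∀ {p : ProjSpace K n} {v}, p ∈ X → v ∈ p.line → v ∈ cone X := by
    intro p v hp hv
    obtain ⟨t, rfl⟩ := mem_line_iff.1 hv
    exact smul_mem_cone t (coords_mem_cone.2 hp)
  have hcone : ∀ {v : Fin (n + 1) → K}, v ∈ cone X → ∃ p ∈ X, v ∈ p.line := by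
    intro v hv
    by_cases hv0 : v = 0
    · obtain ⟨p, hp⟩ := hX
      exact ⟨p, hp, hv0 ▸ zero_mem _⟩
    · obtain ⟨t, ht, h⟩ := exists_coords_ofCoords hv0
      refine ⟨_, hv hv0, mem_line_iff.2 ⟨t⁻¹, ?_⟩⟩
      rw [h, smul_smul, inv_mul_cancel₀ ht, one_smul]
  constructor
  · rintro ⟨P, hP, hq⟩
    have hq' : q.coords ∈ ⨆ i, (P i).line := hq (mem_line_iff.2 ⟨1, (one_smul _ _).symm⟩)
    have hsup : ⨆ i, (P i).line ≤ (P 0).line ⊔ (P 1).line :=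
      iSup_le (Fin.forall_fin_two.2 ⟨le_sup_left, le_sup_right⟩)
    replace hq' := hsup hq'
    rw [Submodule.mem_sup] at hq'
    obtain ⟨a, ha, b, hb, hab⟩ := hq'
    exact ⟨a, hline (hP 0) ha, b, hline (hP 1) hb, hab⟩
  · rintro ⟨a, ha, b, hb, hab⟩
    obtain ⟨p, hp, hpa⟩ := hcone ha
    obtain ⟨p', hp', hpb⟩ := hcone hb
    refine ⟨![p, p'], fun i => by fin_cases i <;> simpa, fun v hv => ?_⟩
    obtain ⟨t, rfl⟩ := mem_line_iff.1 hv
    rw [← hab]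
    refine Submodule.smul_mem _ _ (add_mem ?_ ?_)
    · exact Submodule.mem_iSup_of_mem 0 hpa
    · exact Submodule.mem_iSup_of_mem 1 hpb

/-! ### The dimension of a join -/

/-- The coordinate ring of the join of `X` and `Y` embeds into the ring of functions on the product
of the cones, which is integral over a polynomial ring in `k + k'` variables if the coordinate
rings of `X` and `Y` are integral over polynomial rings in `k` and `k'` linear forms. -/
theorem trdeg_coordRing_join_le [IsAlgClosed K] {X Y : Set (ProjSpace K n)} (hX : IsClosed X)
    (hXi : IsIrreducible X) (hY : IsClosed Y) (hYi : IsIrreducible Y) {k k' : ℕ}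
    {l : Fin k → Module.Dual K (Fin (n + 1) → K)} {l' : Fin k' → Module.Dual K (Fin (n + 1) → K)}
    (hl : NoCommonZero l X) (hl' : NoCommonZero l' Y) :
    Algebra.trdeg K (CoordRing (join X Y)) ≤ (k + k' : ℕ) := by
  have := IsAlgClosed.instInfinite (K := K)
  set I := MvPolynomial.vanishingIdeal K (prodSet (cone X) (cone Y)) with hI
  have hIp : I.IsPrime :=
    isPrime_vanishingIdeal_prodSet (isPrime_coneIdeal hXi) (isPrime_coneIdeal hYi)
  have hker : coneIdeal (join X Y) = I.comap (addHom (Fin (n + 1)) K) := by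
    rw [coneIdeal_join, comap_addHom_vanishingIdeal]
  have hinj : Function.Injective (Ideal.quotientMapₐ I (addHom (Fin (n + 1)) K) hker.le) :=
    Ideal.quotientMap_injective' (H := hker.le) hker.ge
  refine (trdeg_le_of_injective (A := CoordRing (join X Y)) _ hinj).trans ?_
  -- the two inclusions of the coordinate rings of the factors
  let g₁ : CoordRing X →ₐ[K] MvPolynomial (Fin (n + 1) ⊕ Fin (n + 1)) K ⧸ I :=
    Ideal.quotientMapₐ I (MvPolynomial.rename Sum.inl) fun F hF => by
      rw [Ideal.mem_comap, hI, mem_vanishingIdeal]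
      rintro u ⟨h1, h2⟩
      rw [MvPolynomial.eval_rename]
      exact mem_coneIdeal.1 hF _ h1
  let g₂ : CoordRing Y →ₐ[K] MvPolynomial (Fin (n + 1) ⊕ Fin (n + 1)) K ⧸ I :=
    Ideal.quotientMapₐ I (MvPolynomial.rename Sum.inr) fun F hF => by
      rw [Ideal.mem_comap, hI, mem_vanishingIdeal]
      rintro u ⟨h1, h2⟩
      rw [MvPolynomial.eval_rename]
      exact mem_coneIdeal.1 hF _ h2
  let x : Fin k ⊕ Fin k' → MvPolynomial (Fin (n + 1) ⊕ Fin (n + 1)) K ⧸ I :=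
    Sum.elim (fun j => g₁ (formsHom l X (MvPolynomial.X j)))
      fun j => g₂ (formsHom l' Y (MvPolynomial.X j))
  have hint : ∀ a : MvPolynomial (Fin (n + 1) ⊕ Fin (n + 1)) K ⧸ I,
      IsIntegral (Algebra.adjoin K (Set.range x)) a := by
    intro a
    obtain ⟨F, rfl⟩ := Ideal.Quotient.mkₐ_surjective K I a
    induction F using MvPolynomial.induction_on with
    | C c =>
      have : Ideal.Quotient.mkₐ K I (MvPolynomial.C c) =
          algebraMap (Algebra.adjoin K (Set.range x)) _ (algebraMap K _ c) := rfl
      rw [this]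
      exact isIntegral_algebraMap
    | add F G hF hG =>
      rw [map_add]
      exact hF.add hG
    | mul_X F i hF =>
      rw [map_mul]
      refine hF.mul ?_
      rcases i with i | i
      · have : Ideal.Quotient.mkₐ K I (MvPolynomial.X (Sum.inl i)) =
            g₁ (CoordRing.mk X (MvPolynomial.X i)) := by
          change _ = Ideal.Quotient.mkₐ K I (MvPolynomial.rename Sum.inl (MvPolynomial.X i))
          rw [MvPolynomial.rename_X]
        rw [this]
        exact isIntegral_map_of_isIntegralElem ((formsHom_finite hX hl).to_isIntegral _) g₁ _
          fun j => Algebra.subset_adjoin ⟨Sum.inl j, rfl⟩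
      · have : Ideal.Quotient.mkₐ K I (MvPolynomial.X (Sum.inr i)) =
            g₂ (CoordRing.mk Y (MvPolynomial.X i)) := by
          change _ = Ideal.Quotient.mkₐ K I (MvPolynomial.rename Sum.inr (MvPolynomial.X i))
          rw [MvPolynomial.rename_X]
        rw [this]
        exact isIntegral_map_of_isIntegralElem ((formsHom_finite hY hl').to_isIntegral _) g₂ _
          fun j => Algebra.subset_adjoin ⟨Sum.inr j, rfl⟩
  have := trdeg_le_card_of_isIntegral x hint
  simpa using this

theorem dim_join_lt [IsAlgClosed K] {X Y : Set (ProjSpace K n)} (hX : IsClosed X)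
    (hXi : IsIrreducible X) (hY : IsClosed Y) (hYi : IsIrreducible Y) {k k' : ℕ}
    (hXk : topologicalKrullDim X < k) (hYk : topologicalKrullDim Y < k') :
    topologicalKrullDim (join X Y) < (k + k' : ℕ) := by
  obtain ⟨l, hl⟩ := exists_noCommonZero hX hXk
  obtain ⟨l', hl'⟩ := exists_noCommonZero hY hYk
  refine lt_of_trdeg_coordRing_le (isClosed_join X Y) fun T _ _ hT => ?_
  exact (trdeg_le_of_surjective (A := CoordRing (join X Y)) (A' := CoordRing T)
    (Ideal.Quotient.factorₐ K (coneIdeal_anti hT))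
    (Ideal.Quotient.factor_surjective (coneIdeal_anti hT))).trans
    (trdeg_coordRing_join_le hX hXi hY hYi hl hl')

/-! ### Linear subspaces -/

theorem isClosed_coords_mem (W : Submodule K (Fin (n + 1) → K)) :
    IsClosed {p : ProjSpace K n | p.coords ∈ W} := by
  have : {p : ProjSpace K n | p.coords ∈ W} =
      ⋂ f ∈ W.dualAnnihilator, {p | f p.coords = 0} := by
    ext p
    simp only [Set.mem_ofPred_eq, Set.mem_iInter]
    rw [← Subspace.dualAnnihilator_dualCoannihilator_eq (W := W), Submodule.mem_dualCoannihilator,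
      Subspace.dualAnnihilator_dualCoannihilator_eq]
  rw [this]
  exact isClosed_biInter fun f _ => isClosed_linearZeros f

instance t1Space : T1Space (ProjSpace K n) := by
  refine ⟨fun p => ?_⟩
  convert isClosed_coords_mem (Submodule.span K {p.coords}) using 1
  ext q
  rw [Set.mem_singleton_iff, Set.mem_ofPred_eq, Submodule.mem_span_singleton]
  constructor
  · rintro rfl
    exact ⟨1, one_smul _ _⟩
  · rintro ⟨t, ht⟩
    exact eq_of_coords_eq_smul ht.symm

theorem coords_mem_of_mem_join {X Y : Set (ProjSpace K n)} {W : Submodule K (Fin (n + 1) → K)}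
    (hX : ∀ p ∈ X, p.coords ∈ W) (hY : ∀ p ∈ Y, p.coords ∈ W) {p : ProjSpace K n}
    (hp : p ∈ join X Y) : p.coords ∈ W := by
  have hcone : ∀ {Z : Set (ProjSpace K n)}, (∀ p ∈ Z, p.coords ∈ W) → ∀ v ∈ cone Z, v ∈ W := by
    intro Z hZ v hv
    by_cases hv0 : v = 0
    · exact hv0 ▸ zero_mem W
    · obtain ⟨t, ht, h⟩ := exists_coords_ofCoords hv0
      have := hZ _ (hv hv0)
      rw [h] at this
      exact (Submodule.smul_mem_iff W ht).1 this
  refine closure_minimal (t := {p : ProjSpace K n | p.coords ∈ W}) ?_ (isClosed_coords_mem W) hp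
  rintro q ⟨v, hv, w, hw, hvw⟩
  rw [Set.mem_ofPred_eq, ← hvw]
  exact add_mem (hcone hX v hv) (hcone hY w hw)

theorem line_le_iff {p : ProjSpace K n} {W : Submodule K (Fin (n + 1) → K)} :
    p.line ≤ W ↔ p.coords ∈ W := by
  constructor
  · exact fun h => h (mem_line_iff.2 ⟨1, (one_smul _ _).symm⟩)
  · intro h v hv
    obtain ⟨t, rfl⟩ := mem_line_iff.1 hv
    exact W.smul_mem t h

/-- The dimension of a closed subset of the linear subspace defined by `W`. -/
theorem dim_lt_finrank [IsAlgClosed K] {Z : Set (ProjSpace K n)} (hZ : IsClosed Z)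
    (W : Submodule K (Fin (n + 1) → K)) (hW : ∀ p ∈ Z, p.coords ∈ W) :
    topologicalKrullDim Z < Module.finrank K W := by
  obtain ⟨g, hg⟩ := LinearMap.exists_extend (Module.finBasis K W).equivFun.toLinearMap
  have hl : NoCommonZero (fun j => (LinearMap.proj j).comp g) Z := by
    intro v hv h0
    by_contra hv0
    obtain ⟨t, ht, h⟩ := exists_coords_ofCoords hv0
    have hvW : v ∈ W := by
      have := hW _ (hv hv0)
      rw [h] at this
      exact (Submodule.smul_mem_iff W ht).1 this
    have h1 : g v = (Module.finBasis K W).equivFun ⟨v, hvW⟩ :=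
      congrArg (fun f : W →ₗ[K] _ => f ⟨v, hvW⟩) hg
    have h2 : g v = 0 := funext h0
    rw [h2, eq_comm, LinearEquiv.map_eq_zero_iff] at h1
    exact hv0 (congrArg Subtype.val h1)
  exact hl.dim_lt hZ

/-! ### The dimension of the secant variety of a curve -/

/-- A curve contains no irreducible closed subset strictly between itself and a point. -/
theorem IsCurve.eq_of_subset {X L : Set (ProjSpace K n)} (hX : IsCurve X) (hL : IsClosed L)
    (hLi : IsIrreducible L) (hLX : L ⊆ X) {p q : ProjSpace K n} (hp : p ∈ L) (hq : q ∈ L)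
    (hpq : q ≠ p) : L = X := by
  by_contra hne
  have := natCast_le_topologicalKrullDim_of_chain (k := 2) hX.isClosed ![{p}, L, X]
    (by simp [Fin.forall_fin_succ, hL, hX.isClosed])
    (by simp [Fin.forall_fin_succ, hLi, hX.isIrreducible, isIrreducible_singleton])
    (by
      have h1 : {p} ⊂ L := ⟨Set.singleton_subset_iff.2 hp, fun h => hpq (h hq)⟩
      simpa [Fin.forall_fin_succ] using ⟨h1, hLX.ssubset_of_ne hne⟩)
    subset_rfl
  rw [hX.dim_eq_one] at this
  exact absurd this (by decide)

theorem IsCurve.exists_ne {X : Set (ProjSpace K n)} (hX : IsCurve X) (p : ProjSpace K n) :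
    ∃ q ∈ X, q ≠ p := by
  by_contra! hc
  have := (natCast_le_topologicalKrullDim_iff (k := 1) hX.isClosed).1 (by
    rw [hX.dim_eq_one]; rfl)
  obtain ⟨s, hs, hsX⟩ := this
  have h01 : s.head < s.last := by
    refine s.strictMono ?_
    rw [Fin.lt_def]
    simp [hs]
  obtain ⟨x, hx⟩ := s.head.isIrreducible.nonempty
  have hxX := hsX (h01.le hx)
  refine h01.not_ge fun y hy => ?_
  rw [hc y (hsX hy), ← hc x hxX]
  exact hx

/-- A secant variety which is a cone with vertex `p` for each point `p` of `X` contains the linear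
span of `X`. -/
theorem span_subset_cone_join [Infinite K] {X : Set (ProjSpace K n)}
    (h : ∀ p ∈ X, join {p} X = join X X) :
    (Submodule.span K (cone X) : Set (Fin (n + 1) → K)) ⊆ cone (join X X) := by
  have key : ∀ v ∈ Submodule.span K (cone X), ∀ t : K, ∀ z ∈ cone (join X X),
      t • v + z ∈ cone (join X X) := by
    intro v hv
    induction hv using Submodule.span_induction with
    | mem v hv =>
      intro t z hz
      by_cases hv0 : v = 0
      · simpa [hv0] using hz
      · obtain ⟨s, hs, hv'⟩ := exists_coords_ofCoords hv0
        have hp := hv hv0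
        rw [← h _ hp] at hz ⊢
        have := smul_add_mem_cone_join_singleton hz (t * s⁻¹)
        rwa [hv', smul_smul, mul_assoc, inv_mul_cancel₀ hs, mul_one] at this
    | zero => intro t z hz; simpa using hz
    | add v w _ _ ihv ihw =>
      intro t z hz
      rw [smul_add, add_assoc]
      exact ihv t _ (ihw t z hz)
    | smul c v _ ih =>
      intro t z hz
      rw [smul_smul]
      exact ih _ z hz
  intro v hv
  simpa using key v hv 1 0 (zero_mem_cone _)

/-- For a non-planar curve, a point, the curve, the cone over the curve with vertex a general point
of the curve and the secant variety form a chain. -/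
theorem IsCurve.three_le_dim_join [IsAlgClosed K] {X : Set (ProjSpace K n)} (hX : IsCurve X)
    (h : ¬ LiesInPlane X) : ((3 : ℕ) : WithBot ℕ∞) ≤ topologicalKrullDim (join X X) := by
  have := IsAlgClosed.instInfinite (K := K)
  by_contra! hlt
  have hex : ∃ p ∈ X, join {p} X ≠ join X X := by
    by_contra! hc
    refine h ⟨Submodule.span K (cone X), finrank_le_of_subset_cone (isClosed_join X X) hlt _
      (span_subset_cone_join hc), fun p hp => ?_⟩
    exact line_le_iff.2 (Submodule.subset_span (coords_mem_cone.2 hp))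
  obtain ⟨p, hp, hpX⟩ := hex
  obtain ⟨q, hq, hqp⟩ := hX.exists_ne p
  have hpi : IsIrreducible ({p} : Set (ProjSpace K n)) := isIrreducible_singleton
  have hXJ : X ≠ join {p} X := by
    intro heq
    have hsub : join {p} {q} ⊆ X := by
      rw [heq]
      exact join_mono subset_rfl (Set.singleton_subset_iff.2 hq)
    have hL := hX.eq_of_subset (isClosed_join _ _) (isIrreducible_join hpi isIrreducible_singleton)
      hsub (subset_join_left _ _ rfl) (subset_join_right _ _ rfl) hqp
    refine h ⟨Submodule.span K (Set.range ![p.coords, q.coords]),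
      (finrank_range_le_card _).trans (by simp), fun x hx => line_le_iff.2 ?_⟩
    rw [← hL] at hx
    refine coords_mem_of_mem_join ?_ ?_ hx
    · rintro _ rfl
      exact Submodule.subset_span ⟨0, rfl⟩
    · rintro _ rfl
      exact Submodule.subset_span ⟨1, rfl⟩
  refine hlt.not_ge (natCast_le_topologicalKrullDim_of_chain (isClosed_join X X)
    ![{p}, X, join {p} X, join X X] ?_ ?_ ?_ subset_rfl)
  · simp [Fin.forall_fin_succ, hX.isClosed, isClosed_join]
  · simp [Fin.forall_fin_succ, hX.isIrreducible, isIrreducible_join, hpi]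
  · have h1 : {p} ⊂ X := ⟨Set.singleton_subset_iff.2 hp, fun h => hqp (h hq)⟩
    have h2 : X ⊂ join {p} X := (subset_join_right _ _).ssubset_of_ne hXJ
    have h3 : join {p} X ⊂ join X X :=
      (join_mono (Set.singleton_subset_iff.2 hp) subset_rfl).ssubset_of_ne hpX
    simpa [Fin.forall_fin_succ] using ⟨h1, h2, h3⟩

theorem IsCurve.dim_join_lt_four [IsAlgClosed K] {X : Set (ProjSpace K n)} (hX : IsCurve X) :
    topologicalKrullDim (join X X) < (4 : ℕ) := by
  have h : topologicalKrullDim X < (2 : ℕ) := by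
    rw [hX.dim_eq_one]
    decide
  exact dim_join_lt hX.isClosed hX.isIrreducible hX.isClosed hX.isIrreducible h h

theorem IsCurve.dim_join_eq_three_iff [IsAlgClosed K] {X : Set (ProjSpace K n)} (hX : IsCurve X) :
    topologicalKrullDim (join X X) = 3 ↔ ¬ LiesInPlane X := by
  constructor
  · rintro h ⟨W, hW3, hW⟩
    have hW' : ∀ p ∈ X, p.coords ∈ W := fun p hp => line_le_iff.1 (hW p hp)
    have := dim_lt_finrank (isClosed_join X X) W fun p => coords_mem_of_mem_join hW' hW'
    rw [h] at this
    have h' : (3 : ℕ) < Module.finrank K W := by exact_mod_cast this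
    omega
  · intro h
    have h3 := hX.three_le_dim_join h
    have h4 := hX.dim_join_lt_four
    generalize topologicalKrullDim (join X X) = d at *
    induction d with
    | bot => simp at h3
    | coe d =>
      induction d with
      | top => exact absurd (WithBot.coe_lt_coe.1 h4) not_top_lt
      | coe d =>
        have h3' : 3 ≤ d := Nat.cast_le.1 (WithBot.coe_le_coe.1 h3)
        have h4' : d < 4 := Nat.cast_lt.1 (WithBot.coe_lt_coe.1 h4)
        have : d = 3 := by omega
        rw [this]
        rfl

/-! ### Tangent spaces and first order expansions -/

/-- First order Taylor expansion of a polynomial. -/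
theorem aeval_add_sub_mem_sq {σ A : Type*} [Fintype σ] [CommRing A] [Algebra K A] (J : Ideal A)
    (a h : σ → A) (hJ : ∀ i, h i ∈ J) (F : MvPolynomial σ K) :
    MvPolynomial.aeval (a + h) F - MvPolynomial.aeval a F -
      ∑ i, MvPolynomial.aeval a (MvPolynomial.pderiv i F) * h i ∈ J ^ 2 := by
  classical
  induction F using MvPolynomial.induction_on with
  | C c => simp
  | add F G hF hG =>
    convert add_mem hF hG using 1
    simp only [map_add, add_mul, Finset.sum_add_distrib]
    ring
  | mul_X F j hF =>
    have hlin : ∑ i, MvPolynomial.aeval a (MvPolynomial.pderiv i F) * h i ∈ J :=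
      sum_mem fun i _ => J.mul_mem_left _ (hJ i)
    have hsum : ∑ i, MvPolynomial.aeval a (MvPolynomial.pderiv i (F * MvPolynomial.X j)) * h i =
        a j * ∑ i, MvPolynomial.aeval a (MvPolynomial.pderiv i F) * h i +
          MvPolynomial.aeval a F * h j := by
      have hterm : ∀ i, MvPolynomial.aeval a
          (MvPolynomial.pderiv i (F * MvPolynomial.X j)) * h i =
          a j * (MvPolynomial.aeval a (MvPolynomial.pderiv i F) * h i) +
            if i = j then MvPolynomial.aeval a F * h j else 0 := by
        intro i
        rw [Derivation.leibniz, MvPolynomial.pderiv_X]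
        by_cases hij : i = j
        · subst hij
          simp
          ring
        · simp [hij]
          ring
      rw [Finset.sum_congr rfl fun i _ => hterm i, Finset.sum_add_distrib, Finset.mul_sum]
      simp
    rw [hsum]
    convert add_mem (Ideal.mul_mem_right (a j + h j) _ hF)
      (Ideal.mul_mem_mul hlin (hJ j) |> fun h => (pow_two J).symm ▸ h) using 1
    simp only [map_mul, MvPolynomial.aeval_X, Pi.add_apply]
    ring

/-- The differential of `F` at `v`. -/
noncomputable def differential (v : Fin (n + 1) → K) (F : MvPolynomial (Fin (n + 1)) K) :
    Module.Dual K (Fin (n + 1) → K) :=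
  ∑ i, MvPolynomial.eval v (MvPolynomial.pderiv i F) • LinearMap.proj i

theorem differential_apply (v w : Fin (n + 1) → K) (F : MvPolynomial (Fin (n + 1)) K) :
    differential v F w = ∑ i, w i * MvPolynomial.eval v (MvPolynomial.pderiv i F) := by
  simp [differential, mul_comm]

theorem differential_single (v : Fin (n + 1) → K) (F : MvPolynomial (Fin (n + 1)) K)
    (i : Fin (n + 1)) :
    differential v F (Pi.single i 1) = MvPolynomial.eval v (MvPolynomial.pderiv i F) := by
  rw [differential_apply, Finset.sum_eq_single i]
  · simp
  · intro j _ hj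
    simp [hj]
  · simp

/-- The conormal space of `X` at `p`: the span of the differentials at `p` of all forms vanishing
on `X`. -/
def conormalSpace (X : Set (ProjSpace K n)) (p : ProjSpace K n) :
    Submodule K (Module.Dual K (Fin (n + 1) → K)) :=
  Submodule.span K {f | ∃ (d : ℕ) (F : MvPolynomial (Fin (n + 1)) K), F.IsHomogeneous d ∧
    (∀ q ∈ X, MvPolynomial.eval q.coords F = 0) ∧ f = differential p.coords F}

theorem dualCoannihilator_conormalSpace (X : Set (ProjSpace K n)) (p : ProjSpace K n) :
    (conormalSpace X p).dualCoannihilator = tangentSpace X p := by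
  ext w
  rw [conormalSpace, Submodule.mem_dualCoannihilator]
  constructor
  · intro h d F hF hX
    rw [← differential_apply]
    exact h _ (Submodule.subset_span ⟨d, F, hF, hX, rfl⟩)
  · intro h f hf
    induction hf using Submodule.span_induction with
    | mem f hf =>
      obtain ⟨d, F, hF, hX, rfl⟩ := hf
      rw [differential_apply]
      exact h d F hF hX
    | zero => rfl
    | add f g _ _ hf hg => rw [LinearMap.add_apply, hf, hg, add_zero]
    | smul c f _ hf => rw [LinearMap.smul_apply, hf, smul_zero]

theorem dualAnnihilator_tangentSpace (X : Set (ProjSpace K n)) (p : ProjSpace K n) :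
    (tangentSpace X p).dualAnnihilator = conormalSpace X p := by
  rw [← dualCoannihilator_conormalSpace, Subspace.dualCoannihilator_dualAnnihilator_eq]

theorem mem_coneIdeal_of_isHomogeneous {X : Set (ProjSpace K n)} (hX : X.Nonempty) {d : ℕ}
    {F : MvPolynomial (Fin (n + 1)) K} (hF : F.IsHomogeneous d)
    (h : ∀ q ∈ X, MvPolynomial.eval q.coords F = 0) : F ∈ coneIdeal X := by
  rw [mem_coneIdeal]
  intro v hv
  by_cases hv0 : v = 0
  · obtain ⟨q, hq⟩ := hX
    rw [hv0, ← zero_smul K q.coords, eval_smul_of_isHomogeneous hF, h q hq, mul_zero]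
  · exact (eval_coords_ofCoords_eq_zero_iff hF hv0).1 (h _ (hv hv0))

theorem coords_mem_tangentSpace {X : Set (ProjSpace K n)} {p : ProjSpace K n} (hp : p ∈ X) :
    p.coords ∈ tangentSpace X p := by
  intro d F hF hX
  have := congrArg (MvPolynomial.eval p.coords) hF.sum_X_mul_pderiv
  simpa [hX p hp] using this

/-! ### Maximal ideals of the coordinate ring -/

namespace CoordRing

/-- The maximal ideal of functions vanishing at a point of the cone. -/
noncomputable def idealAt {Z : Set (ProjSpace K n)} {v : Fin (n + 1) → K} (hv : v ∈ cone Z) :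
    Ideal (CoordRing Z) :=
  RingHom.ker (evalAt hv)

theorem mem_idealAt {Z : Set (ProjSpace K n)} {v : Fin (n + 1) → K} {hv : v ∈ cone Z}
    {a : CoordRing Z} : a ∈ idealAt hv ↔ evalAt hv a = 0 := Iff.rfl

theorem exists_eq_idealAt [IsAlgClosed K] {Z : Set (ProjSpace K n)} (hZ : IsClosed Z)
    {M : Ideal (CoordRing Z)} (hM : M.IsMaximal) :
    ∃ (u : Fin (n + 1) → K) (hu : u ∈ cone Z), M = idealAt hu := by
  have hM' : (M.comap (mk Z)).IsMaximal :=
    Ideal.comap_isMaximal_of_surjective (mk Z) (mk_surjective Z)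
  obtain ⟨u, hu⟩ := MvPolynomial.isMaximal_iff_eq_vanishingIdeal_singleton.1 hM'
  have hF : ∀ F, mk Z F ∈ M ↔ MvPolynomial.eval u F = 0 := by
    intro F
    rw [← Ideal.mem_comap, hu, mem_vanishingIdeal]
    simp
  have huZ : u ∈ cone Z := (mem_cone_iff_of_isClosed hZ).2 fun F hFZ => by
    rw [← hF, mk_eq_zero_iff.2 hFZ]
    exact zero_mem M
  refine ⟨u, huZ, ?_⟩
  ext a
  obtain ⟨F, rfl⟩ := mk_surjective Z a
  rw [hF, mem_idealAt, evalAt_mk]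

theorem evalAt_aeval {σ : Type*} {Z : Set (ProjSpace K n)} {v : Fin (n + 1) → K} (hv : v ∈ cone Z)
    (a : σ → CoordRing Z) (F : MvPolynomial σ K) :
    evalAt hv (MvPolynomial.aeval a F) = MvPolynomial.eval (fun i => evalAt hv (a i)) F := by
  rw [MvPolynomial.comp_aeval_apply, ← MvPolynomial.aeval_eq_eval]

theorem evalAt_algebraMap {Z : Set (ProjSpace K n)} {v : Fin (n + 1) → K} (hv : v ∈ cone Z)
    (c : K) : evalAt hv (algebraMap K _ c) = c := AlgHom.commutes _ _

theorem evalAt_smul {Z : Set (ProjSpace K n)} {v : Fin (n + 1) → K} (hv : v ∈ cone Z)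
    (c : K) (a : CoordRing Z) : evalAt hv (c • a) = c * evalAt hv a := map_smul _ _ _

theorem aeval_mk_X (Z : Set (ProjSpace K n)) (F : MvPolynomial (Fin (n + 1)) K) :
    MvPolynomial.aeval (fun i => mk Z (MvPolynomial.X i)) F = mk Z F :=
  (congrArg (fun ψ : MvPolynomial (Fin (n + 1)) K →ₐ[K] CoordRing Z => ψ F)
    (MvPolynomial.aeval_unique (mk Z))).symm

end CoordRing

theorem evalAt_formsHom {k : ℕ} (l : Fin k → Module.Dual K (Fin (n + 1) → K))
    {Z : Set (ProjSpace K n)} {u : Fin (n + 1) → K} (hu : u ∈ cone Z)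
    (G : MvPolynomial (Fin k) K) :
    CoordRing.evalAt hu (formsHom l Z G) = MvPolynomial.eval (fun j => l j u) G := by
  rw [formsHom_apply, CoordRing.evalAt_mk, eval_aeval_comp]
  simp

/-! ### Tangent lines lie in the secant variety -/

section Tangent

open CoordRing

/-- The functions `x i - lam * v i` on the cone, extended linearly to all linear forms: this sends
the form `θ` to the function `u ↦ θ (u - lam u • v)`. -/
noncomputable def shiftForm (X : Set (ProjSpace K n)) (v : Fin (n + 1) → K)
    (lam : Module.Dual K (Fin (n + 1) → K)) :
    Module.Dual K (Fin (n + 1) → K) →ₗ[K] CoordRing X where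
  toFun θ := ∑ i, θ (Pi.single i 1) • (mk X (MvPolynomial.X i) - v i • mk X (linForm lam))
  map_add' θ η := by simp [add_smul, Finset.sum_add_distrib]
  map_smul' c θ := by simp [mul_smul, Finset.smul_sum]

theorem shiftForm_apply (X : Set (ProjSpace K n)) (v : Fin (n + 1) → K)
    (lam θ : Module.Dual K (Fin (n + 1) → K)) :
    shiftForm X v lam θ =
      ∑ i, θ (Pi.single i 1) • (mk X (MvPolynomial.X i) - v i • mk X (linForm lam)) := rfl

theorem evalAt_shiftForm {X : Set (ProjSpace K n)} (v : Fin (n + 1) → K)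
    (lam θ : Module.Dual K (Fin (n + 1) → K)) {u : Fin (n + 1) → K} (hu : u ∈ cone X) :
    evalAt hu (shiftForm X v lam θ) = θ (u - lam u • v) := by
  rw [shiftForm_apply, map_sum, dual_apply_eq_sum θ]
  refine Finset.sum_congr rfl fun i _ => ?_
  simp [mul_comm]

theorem shiftForm_self {X : Set (ProjSpace K n)} {v : Fin (n + 1) → K}
    {lam : Module.Dual K (Fin (n + 1) → K)} (hlam : lam v = 1) : shiftForm X v lam lam = 0 :=
  ext_evalAt fun u hu => by simp [evalAt_shiftForm, hlam]

/-- For `lam v = 1`, the ideal of the point `[v]` in the homogeneous coordinate ring, generated by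
the functions `x i - lam * v i`. -/
noncomputable def shiftIdeal (X : Set (ProjSpace K n)) (v : Fin (n + 1) → K)
    (lam : Module.Dual K (Fin (n + 1) → K)) : Ideal (CoordRing X) :=
  Ideal.span (Set.range fun i => shiftForm X v lam (LinearMap.proj i))

theorem shiftForm_proj (X : Set (ProjSpace K n)) (v : Fin (n + 1) → K)
    (lam : Module.Dual K (Fin (n + 1) → K)) (i : Fin (n + 1)) :
    shiftForm X v lam (LinearMap.proj i) =
      mk X (MvPolynomial.X i) - v i • mk X (linForm lam) :=
  ext_evalAt fun u hu => by simp [evalAt_shiftForm, mul_comm]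

theorem shiftForm_proj_mem (X : Set (ProjSpace K n)) (v : Fin (n + 1) → K)
    (lam : Module.Dual K (Fin (n + 1) → K)) (i : Fin (n + 1)) :
    shiftForm X v lam (LinearMap.proj i) ∈ shiftIdeal X v lam := Ideal.subset_span ⟨i, rfl⟩

theorem shiftForm_mem (X : Set (ProjSpace K n)) (v : Fin (n + 1) → K)
    (lam θ : Module.Dual K (Fin (n + 1) → K)) : shiftForm X v lam θ ∈ shiftIdeal X v lam := by
  rw [shiftForm_apply]
  refine sum_mem fun i _ => ?_
  rw [← shiftForm_proj]
  exact Submodule.smul_of_tower_mem _ _ (shiftForm_proj_mem X v lam i)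

theorem shiftIdeal_le_idealAt {X : Set (ProjSpace K n)} {v : Fin (n + 1) → K} (hv : v ∈ cone X)
    {lam : Module.Dual K (Fin (n + 1) → K)} (hlam : lam v = 1) :
    shiftIdeal X v lam ≤ idealAt hv := by
  rw [shiftIdeal, Ideal.span_le]
  rintro _ ⟨i, rfl⟩
  rw [SetLike.mem_coe, mem_idealAt, evalAt_shiftForm, hlam]
  simp

/-- Conormal forms vanish to second order at `p` along `X`. -/
theorem shiftForm_mem_of_mem_conormalSpace {X : Set (ProjSpace K n)} {p : ProjSpace K n}
    (hp : p ∈ X) {lam : Module.Dual K (Fin (n + 1) → K)} (hlam : lam p.coords = 1)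
    {θ : Module.Dual K (Fin (n + 1) → K)} (hθ : θ ∈ conormalSpace X p) :
    shiftForm X p.coords lam θ ∈
      idealAt (coords_mem_cone.2 hp) * shiftIdeal X p.coords lam := by
  set v := p.coords with hv
  have hvX : v ∈ cone X := coords_mem_cone.2 hp
  induction hθ using Submodule.span_induction with
  | zero => rw [map_zero]; exact zero_mem _
  | add f g _ _ hf hg => rw [map_add]; exact add_mem hf hg
  | smul c f _ hf => rw [map_smul]; exact Submodule.smul_of_tower_mem _ _ hf
  | mem θ hθ =>
    obtain ⟨d, F, hF, hFX, rfl⟩ := hθ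
    have hFI : F ∈ coneIdeal X := mem_coneIdeal_of_isHomogeneous ⟨p, hp⟩ hF hFX
    set ℓ := mk X (linForm lam) with hℓ
    -- expansion of `F` along `x = ℓ • v + (x - ℓ • v)`
    have htaylor := aeval_add_sub_mem_sq (shiftIdeal X v lam) (fun i => v i • ℓ)
      (fun i => shiftForm X v lam (LinearMap.proj i)) (shiftForm_proj_mem X v lam) F
    have hsum : ((fun i => v i • ℓ) + fun i => shiftForm X v lam (LinearMap.proj i)) =
        fun i => mk X (MvPolynomial.X i) := by
      funext i
      rw [Pi.add_apply, shiftForm_proj, add_sub_cancel]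
    have hhom : ∀ {e : ℕ} {G : MvPolynomial (Fin (n + 1)) K}, G.IsHomogeneous e →
        MvPolynomial.aeval (fun i => v i • ℓ) G = MvPolynomial.eval v G • ℓ ^ e := by
      intro e G hG
      refine ext_evalAt fun u hu => ?_
      have : (fun i => evalAt hu (v i • ℓ)) = lam u • v := by
        funext i
        rw [evalAt_smul, hℓ, evalAt_mk, eval_linForm, Pi.smul_apply, smul_eq_mul, mul_comm]
      rw [evalAt_aeval, this, eval_smul_of_isHomogeneous hG, evalAt_smul, map_pow, hℓ, evalAt_mk,
        eval_linForm, mul_comm]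
    rw [hsum, aeval_mk_X, mk_eq_zero_iff.2 hFI, hhom hF, hv, hFX p hp, zero_smul, sub_zero,
      zero_sub, neg_mem_iff, ← hv] at htaylor
    have hlin : ∑ i, MvPolynomial.aeval (fun i => v i • ℓ) (MvPolynomial.pderiv i F) *
        shiftForm X v lam (LinearMap.proj i) =
        ℓ ^ (d - 1) * shiftForm X v lam (differential v F) := by
      rw [shiftForm_apply, Finset.mul_sum]
      refine Finset.sum_congr rfl fun i _ => ?_
      rw [hhom hF.pderiv, differential_single, shiftForm_proj, smul_mul_assoc, mul_smul_comm]
    rw [hlin] at htaylor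
    have h1 : ℓ ^ (d - 1) * shiftForm X v lam (differential v F) ∈
        idealAt hvX * shiftIdeal X v lam := by
      rw [pow_two] at htaylor
      exact Ideal.mul_mono_left (shiftIdeal_le_idealAt hvX hlam) htaylor
    have h2 : (1 - ℓ ^ (d - 1)) * shiftForm X v lam (differential v F) ∈
        idealAt hvX * shiftIdeal X v lam := by
      refine Ideal.mul_mem_mul ?_ (shiftForm_mem X v lam _)
      rw [mem_idealAt, map_sub, map_one, map_pow, hℓ, evalAt_mk, eval_linForm, hlam, one_pow,
        sub_self]
    convert add_mem h1 h2 using 1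
    ring

theorem exists_dual_pair {v w : Fin (n + 1) → K} (hw : w ∉ Submodule.span K {v}) :
    ∃ f : Module.Dual K (Fin (n + 1) → K), f v = 0 ∧ f w = 1 := by
  obtain ⟨f, hfw, hf⟩ := Submodule.exists_le_ker_of_notMem hw
  have hfv : f v = 0 := hf (Submodule.mem_span_singleton_self v)
  refine ⟨(f w)⁻¹ • f, ?_, ?_⟩
  · simp [hfv]
  · simp [inv_mul_cancel₀ hfw]

/-- At a smooth point of a curve the embedded tangent line is contained in the secant variety.

The ideal `q` of the point is principal modulo `m * q`, where `m` is the maximal ideal of the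
chosen vector `v` on the line `p`. By Nakayama's lemma `g * q ⊆ (b)` for some function `g` with
`g v = 1`, so that the secant directions `x - lam * v` at `p` are, up to the factor `g`, multiples by
`b` of a vector `a` of functions, and the value of `a` at `v` is the tangent direction. A form which
vanishes on the secant variety vanishes at `x - lam * v`, hence at `a`, as the coordinate ring is a
domain. -/
theorem IsCurve.mem_cone_join_of_mem_tangentSpace [IsAlgClosed K] {X : Set (ProjSpace K n)}
    (hX : IsCurve X) {p : ProjSpace K n} (hp : p ∈ X)
    (hT : Module.finrank K (tangentSpace X p) = 2) {w : Fin (n + 1) → K}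
    (hw : w ∈ tangentSpace X p) : w ∈ cone (join X X) := by
  have := IsAlgClosed.instInfinite (K := K)
  have := isDomain hX.isIrreducible
  set v := p.coords with hv
  have hvX : v ∈ cone X := coords_mem_cone.2 hp
  by_cases hwv : w ∈ Submodule.span K {v}
  · obtain ⟨t, rfl⟩ := Submodule.mem_span_singleton.1 hwv
    exact cone_mono (subset_join_left X X) (smul_mem_cone t hvX)
  have hv0 : v ≠ 0 := p.coords_ne_zero
  have hvw : v ∉ Submodule.span K {w} := by
    intro h
    obtain ⟨t, ht⟩ := Submodule.mem_span_singleton.1 h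
    have ht0 : t ≠ 0 := by
      rintro rfl
      exact hv0 (by rw [← ht, zero_smul])
    exact hwv (Submodule.mem_span_singleton.2 ⟨t⁻¹, by
      rw [← ht, smul_smul, inv_mul_cancel₀ ht0, one_smul]⟩)
  obtain ⟨lam, hlamw, hlamv⟩ := exists_dual_pair hvw
  obtain ⟨bet, hbetv, hbetw⟩ := exists_dual_pair hwv
  -- the tangent space is spanned by `v` and `w`
  have hTspan : ∀ y ∈ tangentSpace X p, y = lam y • v + bet y • w := by
    have hle : Submodule.span K {v, w} ≤ tangentSpace X p := by
      rw [Submodule.span_le]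
      rintro _ (rfl | rfl)
      · exact coords_mem_tangentSpace hp
      · exact hw
    have hli : LinearIndependent K ![v, w] := by
      rw [LinearIndependent.pair_iff]
      intro s t hst
      have h1 := congrArg lam hst
      have h2 := congrArg bet hst
      simp only [map_add, map_smul, hlamv, hlamw, hbetv, hbetw, smul_eq_mul, map_zero, mul_one,
        mul_zero, add_zero, zero_add] at h1 h2
      exact ⟨h1, h2⟩
    have hrank : Module.finrank K (Submodule.span K {v, w}) = 2 := by
      have := finrank_span_eq_card hli
      rwa [Matrix.range_cons, Matrix.range_cons, Matrix.range_empty, Set.union_empty,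
        Set.singleton_union] at this
    have heq := Submodule.eq_of_le_of_finrank_eq hle (hrank.trans hT.symm)
    intro y hy
    rw [← heq, Submodule.mem_span_pair] at hy
    obtain ⟨s, t, rfl⟩ := hy
    simp [hlamv, hlamw, hbetv, hbetw]
  set b := shiftForm X v lam bet with hb
  have hfg : (shiftIdeal X v lam).FG := IsNoetherian.noetherian _
  have hle : shiftIdeal X v lam ≤
      Ideal.span {b} ⊔ idealAt hvX • shiftIdeal X v lam := by
    conv_lhs => rw [shiftIdeal]
    rw [Ideal.span_le]
    rintro _ ⟨i, rfl⟩
    let θ : Module.Dual K (Fin (n + 1) → K) := LinearMap.proj i - v i • lam - w i • bet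
    have hθ : θ ∈ conormalSpace X p := by
      rw [← dualAnnihilator_tangentSpace, Submodule.mem_dualAnnihilator]
      intro y hy
      have := congrFun (hTspan y hy) i
      simp only [Pi.add_apply, Pi.smul_apply, smul_eq_mul] at this
      simp only [θ, LinearMap.sub_apply, LinearMap.smul_apply, LinearMap.proj_apply, smul_eq_mul]
      rw [this]
      ring
    have hproj : shiftForm X v lam (LinearMap.proj i) = w i • b + shiftForm X v lam θ := by
      simp only [θ, map_sub, map_smul, shiftForm_self hlamv, smul_zero, sub_zero, hb]
      abel
    change shiftForm X v lam (LinearMap.proj i) ∈ _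
    rw [hproj]
    exact Submodule.add_mem_sup
      (Submodule.smul_of_tower_mem _ _ (Ideal.mem_span_singleton_self b))
      (shiftForm_mem_of_mem_conormalSpace hp hlamv hθ)
  obtain ⟨g, hg1, hg⟩ := Submodule.exists_sub_one_mem_and_smul_le_of_fg_of_le_sup hfg le_rfl hle
  have hgv : evalAt hvX g = 1 := by
    rw [mem_idealAt, map_sub, map_one, sub_eq_zero] at hg1
    exact hg1
  have hga : ∀ q ∈ shiftIdeal X v lam, ∃ c, c * b = g * q := fun q hq =>
    Ideal.mem_span_singleton'.1 (hg (Submodule.smul_mem_pointwise_smul q g _ hq))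
  choose a ha using fun i => hga _ (shiftForm_proj_mem X v lam i)
  have hb0 : b ≠ 0 := by
    intro hb0
    obtain ⟨q, hq, hqp⟩ := hX.exists_ne p
    refine hqp (eq_of_coords_eq_smul (t := lam q.coords) ?_)
    have hg0 : g ≠ 0 := by
      rintro rfl
      simp at hgv
    funext i
    have h1 := ha i
    rw [hb0, mul_zero, eq_comm, mul_eq_zero, or_iff_right hg0] at h1
    have h2 := congrArg (evalAt (coords_mem_cone.2 hq)) h1
    rw [evalAt_shiftForm, map_zero] at h2
    simpa [sub_eq_zero] using h2
  -- the vector of functions `a` applied to a linear form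
  have hlin : ∀ θ : Module.Dual K (Fin (n + 1) → K),
      (∑ i, θ (Pi.single i 1) • a i) * b = g * shiftForm X v lam θ := by
    intro θ
    rw [shiftForm_apply, Finset.sum_mul, Finset.mul_sum]
    refine Finset.sum_congr rfl fun i _ => ?_
    rw [smul_mul_assoc, ha, shiftForm_proj, mul_smul_comm]
  let y : Fin (n + 1) → K := fun i => evalAt hvX (a i)
  have hy : ∀ θ : Module.Dual K (Fin (n + 1) → K),
      evalAt hvX (∑ i, θ (Pi.single i 1) • a i) = θ y := by
    intro θ
    rw [map_sum, dual_apply_eq_sum θ y]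
    exact Finset.sum_congr rfl fun i _ => evalAt_smul _ _ _
  have hylam : lam y = 0 := by
    have := hlin lam
    rw [shiftForm_self hlamv, mul_zero, mul_eq_zero, or_iff_left hb0] at this
    rw [← hy, this, map_zero]
  have hybet : bet y = 1 := by
    have := mul_right_cancel₀ hb0 (hlin bet)
    rw [← hy, this, hgv]
  have hyT : y ∈ tangentSpace X p := by
    rw [← dualCoannihilator_conormalSpace, Submodule.mem_dualCoannihilator]
    intro θ hθ
    have hmem : g * shiftForm X v lam θ ∈ idealAt hvX * Ideal.span {b} := by
      have h1 : g * shiftForm X v lam θ ∈ Ideal.span {g} * (idealAt hvX * shiftIdeal X v lam) :=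
        Ideal.mul_mem_mul (Ideal.mem_span_singleton_self g)
          (shiftForm_mem_of_mem_conormalSpace hp hlamv hθ)
      rw [mul_left_comm] at h1
      refine Ideal.mul_mono_right ?_ h1
      rw [Ideal.mul_le]
      intro r hr q hq
      obtain ⟨c, rfl⟩ := Ideal.mem_span_singleton'.1 hr
      obtain ⟨c', hc'⟩ := hga q hq
      rw [mul_assoc, ← hc', ← mul_assoc]
      exact Ideal.mul_mem_left _ _ (Ideal.mem_span_singleton_self b)
    obtain ⟨μ, hμ, hμb⟩ := Ideal.mem_mul_span_singleton.1 hmem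
    rw [← hlin] at hμb
    rw [← hy, ← mul_right_cancel₀ hb0 hμb]
    exact hμ
  have hyw : y = w := by rw [hTspan y hyT, hylam, hybet, zero_smul, one_smul, zero_add]
  rw [mem_cone_iff_of_isClosed (isClosed_join X X)]
  intro F hF
  rw [eval_eq_sum_homogeneousComponent]
  refine Finset.sum_eq_zero fun e _ => ?_
  have hFe := MvPolynomial.homogeneousComponent_isHomogeneous e F
  have hFI := homogeneousComponent_mem_coneIdeal hF e
  set G := MvPolynomial.homogeneousComponent e F
  have h1 : b ^ e * MvPolynomial.aeval a G = 0 := by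
    refine ext_evalAt fun u hu => ?_
    have h2 : (evalAt hu b) • (fun i => evalAt hu (a i)) =
        evalAt hu g • u + (-(evalAt hu g * lam u)) • v := by
      funext i
      have := congrArg (evalAt hu) (ha i)
      rw [map_mul, map_mul, evalAt_shiftForm v lam (LinearMap.proj i)] at this
      simp only [Pi.add_apply, Pi.smul_apply, smul_eq_mul]
      rw [mul_comm, this]
      simp
      ring
    rw [map_mul, map_pow, evalAt_aeval, ← eval_smul_of_isHomogeneous hFe, h2, map_zero]
    exact mem_coneIdeal.1 hFI _
      (add_mem_cone_join (smul_mem_cone _ hu) (smul_mem_cone _ hvX))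
  have h2 : MvPolynomial.aeval a G = 0 := (mul_eq_zero.1 h1).resolve_left (pow_ne_zero _ hb0)
  have h3 := congrArg (evalAt hvX) h2
  rw [evalAt_aeval, map_zero] at h3
  rw [← hyw]
  exact h3

end Tangent

/-! ### Linear projections: the inverse map -/

section Inverse

open CoordRing

/-- Let the linear forms `l` have no common zero on `Z`, separate the point `v` of the cone from all
others, and together with the conormal space at `p = [v]` span all linear forms. Then the coordinate
functions of `Z` are, after multiplication with a polynomial in `l` which does not vanish at
`v`, polynomials in `l`.

The maximal ideal of `v` in the coordinate ring `A` is generated by the functions `l j - l j v`, by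
Nakayama's lemma, as it is generated by them modulo its square and is the only maximal ideal
containing them. Hence `A` is generated by `1` as a module over the polynomial ring in `l`
near `v`, by Nakayama's lemma once more. -/
theorem exists_inverse_polynomials [IsAlgClosed K] {Z : Set (ProjSpace K n)} (hZ : IsClosed Z)
    {k : ℕ} {l : Fin k → Module.Dual K (Fin (n + 1) → K)} (hl : NoCommonZero l Z)
    {p : ProjSpace K n} (hp : p ∈ Z)
    (hinj : ∀ u ∈ cone Z, (∀ j, l j u = l j p.coords) → u = p.coords)
    (htan : Submodule.span K (Set.range l) ⊔ conormalSpace Z p = ⊤) :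
    ∃ (b : MvPolynomial (Fin k) K) (c : Fin (n + 1) → MvPolynomial (Fin k) K),
      MvPolynomial.eval (fun j => l j p.coords) b ≠ 0 ∧
      ∀ u ∈ cone Z, ∀ i, MvPolynomial.eval (fun j => l j u) b * u i =
        MvPolynomial.eval (fun j => l j u) (c i) := by
  set v := p.coords with hv
  have hvZ : v ∈ cone Z := coords_mem_cone.2 hp
  let J : Ideal (CoordRing Z) := Ideal.span (Set.range fun j =>
    formsHom l Z (MvPolynomial.X j) - algebraMap K _ (l j v))
  let M : Ideal (CoordRing Z) := idealAt hvZ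
  let x : Fin (n + 1) → CoordRing Z := fun i => mk Z (MvPolynomial.X i) - algebraMap K _ (v i)
  have hxM : ∀ i, x i ∈ M := fun i => by
    rw [mem_idealAt, map_sub, evalAt_mk, evalAt_algebraMap, MvPolynomial.eval_X, sub_self]
  let D : Module.Dual K (Fin (n + 1) → K) →ₗ[K] CoordRing Z :=
    { toFun := fun θ => ∑ i, θ (Pi.single i 1) • x i
      map_add' := fun θ η => by simp [add_smul, Finset.sum_add_distrib]
      map_smul' := fun c θ => by simp [mul_smul, Finset.smul_sum] }
  have hDapply : ∀ θ, D θ = ∑ i, θ (Pi.single i 1) • x i := fun _ => rfl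
  have htaylor : ∀ F, mk Z F - algebraMap K _ (MvPolynomial.eval v F) - D (differential v F) ∈
      M ^ 2 := by
    intro F
    have h := aeval_add_sub_mem_sq M (fun i => algebraMap K (CoordRing Z) (v i)) x hxM F
    have hsum : ((fun i => algebraMap K (CoordRing Z) (v i)) + x) =
        fun i => mk Z (MvPolynomial.X i) := by
      funext i
      simp only [Pi.add_apply, x]
      rw [add_sub_cancel]
    have hconst : ∀ G : MvPolynomial (Fin (n + 1)) K,
        MvPolynomial.aeval (fun i => algebraMap K (CoordRing Z) (v i)) G =
          algebraMap K _ (MvPolynomial.eval v G) := fun G =>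
      ext_evalAt fun u hu => by simp only [evalAt_aeval, evalAt_algebraMap]
    rw [hsum, aeval_mk_X, hconst] at h
    convert h using 2
    rw [hDapply]
    refine Finset.sum_congr rfl fun i _ => ?_
    rw [differential_single, hconst, Algebra.smul_def]
  have hD : ∀ θ, D θ ∈ J ⊔ M ^ 2 := by
    have hle : Submodule.span K (Set.range l) ⊔ conormalSpace Z p ≤
        ((J ⊔ M ^ 2).restrictScalars K).comap D := by
      rw [sup_le_iff, conormalSpace, Submodule.span_le, Submodule.span_le]
      constructor
      · rintro _ ⟨j, rfl⟩
        refine Ideal.mem_sup_left ?_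
        have : D (l j) = formsHom l Z (MvPolynomial.X j) - algebraMap K _ (l j v) := by
          refine ext_evalAt fun u hu => ?_
          rw [hDapply, map_sum, map_sub, evalAt_formsHom, evalAt_algebraMap, MvPolynomial.eval_X,
            ← map_sub, dual_apply_eq_sum (l j)]
          refine Finset.sum_congr rfl fun i _ => ?_
          rw [evalAt_smul, map_sub, evalAt_mk, evalAt_algebraMap, MvPolynomial.eval_X]
          rfl
        rw [this]
        exact Ideal.subset_span ⟨j, rfl⟩
      · rintro _ ⟨d, F, hF, hFZ, rfl⟩
        refine Ideal.mem_sup_right ?_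
        have h := htaylor F
        rw [mk_eq_zero_iff.2 (mem_coneIdeal_of_isHomogeneous ⟨p, hp⟩ hF hFZ), hv, hFZ p hp,
          map_zero, sub_zero, zero_sub, neg_mem_iff] at h
        exact h
    exact fun θ => hle (htan ▸ Submodule.mem_top)
  have hM : M ≤ J ⊔ M • M := by
    intro a ha
    obtain ⟨F, rfl⟩ := mk_surjective Z a
    have hF : MvPolynomial.eval v F = 0 := by
      rw [← evalAt_mk hvZ]
      exact ha
    have h := htaylor F
    rw [hF, map_zero, sub_zero] at h
    rw [smul_eq_mul, ← pow_two, ← sub_add_cancel (mk Z F) (D (differential v F))]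
    exact add_mem (Ideal.mem_sup_right h) (hD _)
  obtain ⟨r, hr1, hr⟩ := Submodule.exists_sub_one_mem_and_smul_le_of_fg_of_le_sup
    (IsNoetherian.noetherian M) le_rfl hM
  have htop : J ⊔ Ideal.span {r} = ⊤ := by
    by_contra hne
    obtain ⟨N, hN, hle⟩ := Ideal.exists_le_maximal _ hne
    obtain ⟨u, hu, rfl⟩ := exists_eq_idealAt hZ hN
    have huv : u = v := hinj u hu fun j => by
      have : formsHom l Z (MvPolynomial.X j) - algebraMap K _ (l j v) ∈ idealAt hu :=
        hle (Ideal.mem_sup_left (Ideal.subset_span ⟨j, rfl⟩))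
      rw [mem_idealAt, map_sub, evalAt_formsHom, evalAt_algebraMap, MvPolynomial.eval_X,
        sub_eq_zero] at this
      exact this
    subst huv
    have h1 : r ∈ idealAt hu := hle (Ideal.mem_sup_right (Ideal.mem_span_singleton_self r))
    exact hN.ne_top ((Ideal.eq_top_iff_one _).2 (by simpa using sub_mem h1 hr1))
  have hMJ : M ≤ J := by
    intro a ha
    obtain ⟨s, hs, t, ht, hst⟩ := Submodule.mem_sup.1 ((Ideal.eq_top_iff_one _).1 htop)
    obtain ⟨t, rfl⟩ := Ideal.mem_span_singleton'.1 ht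
    have : a = a * s + t * (r * a) := by
      rw [← mul_assoc, mul_comm _ a, ← mul_add, hst, mul_one]
    rw [this]
    exact add_mem (J.mul_mem_left _ hs)
      (J.mul_mem_left _ (hr (Submodule.smul_mem_pointwise_smul a r M ha)))
  let : Algebra (MvPolynomial (Fin k) K) (CoordRing Z) := (formsHom l Z).toRingHom.toAlgebra
  have hsmul : ∀ (G : MvPolynomial (Fin k) K) (a : CoordRing Z), G • a = formsHom l Z G * a :=
    fun _ _ => rfl
  have hfin : Module.Finite (MvPolynomial (Fin k) K) (CoordRing Z) := formsHom_finite hZ hl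
  let N : Ideal (MvPolynomial (Fin k) K) := RingHom.ker (MvPolynomial.eval fun j => l j v)
  have hsup : (⊤ : Submodule (MvPolynomial (Fin k) K) (CoordRing Z)) ≤
      LinearMap.range (Algebra.linearMap (MvPolynomial (Fin k) K) (CoordRing Z)) ⊔ N • ⊤ := by
    intro a _
    have hsub : a - algebraMap K _ (evalAt hvZ a) ∈ J := hMJ (by
      rw [mem_idealAt, map_sub, evalAt_algebraMap, sub_self])
    rw [← add_sub_cancel (algebraMap K _ (evalAt hvZ a)) a]
    refine Submodule.add_mem_sup ⟨MvPolynomial.C (evalAt hvZ a), ?_⟩ ?_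
    · exact (formsHom l Z).commutes _
    · obtain ⟨c, hc⟩ := Ideal.mem_span_range_iff_exists_fun.1 hsub
      rw [← hc]
      refine sum_mem fun j _ => ?_
      have : c j * (formsHom l Z (MvPolynomial.X j) - algebraMap K _ (l j v)) =
          (MvPolynomial.X j - MvPolynomial.C (l j v) : MvPolynomial (Fin k) K) • c j := by
        rw [hsmul, map_sub, mul_comm, ← MvPolynomial.algebraMap_eq, AlgHom.commutes]
      rw [this]
      refine Submodule.smul_mem_smul ?_ Submodule.mem_top
      rw [RingHom.mem_ker]
      simp
  obtain ⟨b, hb1, hb⟩ := Submodule.exists_sub_one_mem_and_smul_le_of_fg_of_le_sup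
    hfin.fg_top le_rfl hsup
  have hb' : MvPolynomial.eval (fun j => l j v) b = 1 := by
    rw [RingHom.mem_ker, map_sub, map_one, sub_eq_zero] at hb1
    exact hb1
  choose c hc using fun i : Fin (n + 1) =>
    hb (Submodule.smul_mem_pointwise_smul (mk Z (MvPolynomial.X i)) b ⊤ Submodule.mem_top)
  refine ⟨b, c, by rw [hb']; exact one_ne_zero, fun u hu i => ?_⟩
  have h : formsHom l Z (c i) = formsHom l Z b * mk Z (MvPolynomial.X i) := hc i
  have := congrArg (evalAt hu) h
  rw [map_mul, evalAt_formsHom, evalAt_formsHom, evalAt_mk, MvPolynomial.eval_X] at this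
  exact this.symm

/-- The homogeneous version of `exists_inverse_polynomials`. -/
theorem exists_inverse_forms [IsAlgClosed K] {Z : Set (ProjSpace K n)} (hZ : IsClosed Z)
    {k : ℕ} {l : Fin k → Module.Dual K (Fin (n + 1) → K)} (hl : NoCommonZero l Z)
    {p : ProjSpace K n} (hp : p ∈ Z)
    (hinj : ∀ u ∈ cone Z, (∀ j, l j u = l j p.coords) → u = p.coords)
    (htan : Submodule.span K (Set.range l) ⊔ conormalSpace Z p = ⊤) :
    ∃ (d : ℕ) (b : MvPolynomial (Fin k) K) (c : Fin (n + 1) → MvPolynomial (Fin k) K),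
      b.IsHomogeneous d ∧ (∀ i, (c i).IsHomogeneous (d + 1)) ∧
      MvPolynomial.eval (fun j => l j p.coords) b ≠ 0 ∧
      ∀ u ∈ cone Z, ∀ i, MvPolynomial.eval (fun j => l j u) b * u i =
        MvPolynomial.eval (fun j => l j u) (c i) := by
  have := IsAlgClosed.instInfinite (K := K)
  obtain ⟨b, c, hb, hbc⟩ := exists_inverse_polynomials hZ hl hp hinj htan
  obtain ⟨d, hd⟩ := exists_eval_homogeneousComponent_ne_zero hb
  refine ⟨d, MvPolynomial.homogeneousComponent d b,
    fun i => MvPolynomial.homogeneousComponent (d + 1) (c i),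
    MvPolynomial.homogeneousComponent_isHomogeneous d b,
    fun i => MvPolynomial.homogeneousComponent_isHomogeneous (d + 1) (c i), hd,
    fun u hu i => ?_⟩
  -- compare coefficients along the line through `u`
  have hpoly : MvPolynomial.aeval (fun j => Polynomial.C (l j u) * Polynomial.X) b *
      Polynomial.C (u i) * Polynomial.X =
      MvPolynomial.aeval (fun j => Polynomial.C (l j u) * Polynomial.X) (c i) := by
    refine Polynomial.funext fun t => ?_
    have h := hbc (t • u) (smul_mem_cone t hu) i
    have hlt : (fun j => l j (t • u)) = t • fun j => l j u := funext fun j => by simp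
    rw [hlt] at h
    rw [Polynomial.eval_mul, Polynomial.eval_mul, Polynomial.eval_C, Polynomial.eval_X,
      eval_aeval_C_mul_X, eval_aeval_C_mul_X, ← h, Pi.smul_apply, smul_eq_mul, mul_assoc,
      mul_comm t]
  rw [← coeff_aeval_C_mul_X, ← coeff_aeval_C_mul_X, ← hpoly, Polynomial.coeff_mul_X,
    Polynomial.coeff_mul_C]

end Inverse

/-! ### Linear projections as closed maps -/

section Projection

variable {l : Fin (m + 1) → Module.Dual K (Fin (n + 1) → K)} {Z : Set (ProjSpace K n)}

theorem NoCommonZero.apply_coords_ne_zero (hl : NoCommonZero l Z) {p : ProjSpace K n}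
    (hp : p ∈ Z) : (fun j => l j p.coords) ≠ 0 := fun h =>
  p.coords_ne_zero (hl _ (coords_mem_cone.2 hp) fun j => congrFun h j)

/-- The projection of `Z` to projective `m`-space by linear forms without common zeros on `Z`. -/
noncomputable def linProj (hl : NoCommonZero l Z) (p : Z) : ProjSpace K m :=
  ofCoords (fun j => l j (p : ProjSpace K n).coords) (hl.apply_coords_ne_zero p.2)

theorem continuous_linProj (hl : NoCommonZero l Z) : Continuous (linProj hl) := by
  refine continuous_iff_isClosed.2 fun C hC => ?_
  obtain ⟨S, hS, rfl⟩ := isClosed_iff.1 hC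
  have hcl : IsClosed (⋂ F ∈ S, zeroLocus
      {MvPolynomial.aeval (fun j => linForm (l j)) F} : Set (ProjSpace K n)) := by
    refine isClosed_biInter fun F hF => ?_
    obtain ⟨d, hd⟩ := hS F hF
    exact isClosed_zeroLocus_singleton (hd.aeval _ fun j => isHomogeneous_linForm (l j))
  convert hcl.preimage continuous_subtype_val using 1
  ext p
  simp only [Set.mem_preimage, Set.mem_iInter, zeroLocus, Set.mem_ofPred_eq, Set.mem_singleton_iff,
    forall_eq]
  refine forall₂_congr fun F hF => ?_
  obtain ⟨d, hd⟩ := hS F hF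
  rw [linProj, eval_coords_ofCoords_eq_zero_iff hd, eval_aeval_comp]
  simp

/-- The image of a projective algebraic set under a projection from a disjoint center is closed, by
lying over for the integral extension of homogeneous coordinate rings. -/
theorem isClosed_image_linProj [IsAlgClosed K] (hZ : IsClosed Z) (hl : NoCommonZero l Z) :
    IsClosed (Set.range (linProj hl)) := by
  have := IsAlgClosed.instInfinite (K := K)
  refine isClosed_of_closure_subset fun q hq => ?_
  let D : Set (Fin (m + 1) → K) := (fun u j => l j u) '' cone Z
  have hD : ∀ (t : K), ∀ w ∈ D, t • w ∈ D := by
    rintro t _ ⟨u, hu, rfl⟩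
    exact ⟨t • u, smul_mem_cone t hu, funext fun j => by simp⟩
  have hqD : q ∈ projClosure D := by
    refine closure_mono ?_ hq
    rintro _ ⟨p, rfl⟩
    obtain ⟨t, -, ht⟩ := exists_coords_ofCoords (hl.apply_coords_ne_zero p.2)
    rw [Set.mem_ofPred_eq, linProj, ht]
    exact hD t _ ⟨_, coords_mem_cone.2 p.2, rfl⟩
  have hqI : ∀ G ∈ MvPolynomial.vanishingIdeal K D, MvPolynomial.eval q.coords G = 0 := by
    intro G hG
    rw [← coneIdeal_projClosure hD ⟨_, 0, zero_mem_cone Z, rfl⟩] at hG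
    exact mem_coneIdeal.1 hG _ (coords_mem_cone.2 hqD)
  let : Algebra (MvPolynomial (Fin (m + 1)) K) (CoordRing Z) := (formsHom l Z).toRingHom.toAlgebra
  have hint : Algebra.IsIntegral (MvPolynomial (Fin (m + 1)) K) (CoordRing Z) :=
    ⟨(formsHom_finite hZ hl).to_isIntegral⟩
  have hmax : (MvPolynomial.vanishingIdeal K {q.coords}).IsMaximal := inferInstance
  obtain ⟨M, hM, hMq⟩ := Ideal.exists_ideal_over_maximal_of_isIntegral (S := CoordRing Z)
    (MvPolynomial.vanishingIdeal K {q.coords}) (by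
      intro G hG
      rw [mem_vanishingIdeal]
      rintro _ rfl
      refine hqI G (mem_vanishingIdeal.2 ?_)
      rintro _ ⟨u, hu, rfl⟩
      have hG0 : formsHom l Z G = 0 := hG
      rw [← evalAt_formsHom l hu, hG0, map_zero])
  obtain ⟨u, hu, rfl⟩ := CoordRing.exists_eq_idealAt hZ hM
  have hlu : (fun j => l j u) = q.coords := by
    funext j
    have h1 : (MvPolynomial.X j - MvPolynomial.C (q.coords j) : MvPolynomial (Fin (m + 1)) K) ∈
        MvPolynomial.vanishingIdeal K {q.coords} := by
      rw [mem_vanishingIdeal]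
      rintro _ rfl
      simp
    rw [← hMq] at h1
    have h2 : CoordRing.evalAt hu (formsHom l Z
      (MvPolynomial.X j - MvPolynomial.C (q.coords j))) = 0 := h1
    rw [evalAt_formsHom] at h2
    simpa [sub_eq_zero] using h2
  have hu0 : u ≠ 0 := by
    rintro rfl
    exact q.coords_ne_zero (by rw [← hlu]; funext j; simp)
  obtain ⟨t, -, ht⟩ := exists_coords_ofCoords hu0
  refine ⟨⟨_, hu hu0⟩, ?_⟩
  rw [linProj, ← ofCoords_coords q, ofCoords_eq_iff]
  exact ⟨t, by rw [← hlu]; funext j; simp [ht]⟩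

theorem isClosedMap_linProj [IsAlgClosed K] (hZ : IsClosed Z) (hl : NoCommonZero l Z) :
    IsClosedMap (linProj hl) := by
  intro C hC
  have hC' : IsClosed ((↑) '' C : Set (ProjSpace K n)) :=
    hZ.isClosedEmbedding_subtypeVal.isClosedMap C hC
  have hsub : ((↑) '' C : Set (ProjSpace K n)) ⊆ Z := by
    rintro _ ⟨p, -, rfl⟩
    exact p.2
  convert isClosed_image_linProj hC' (hl.mono hsub) using 1
  ext q
  constructor
  · rintro ⟨p, hp, rfl⟩
    exact ⟨⟨p, p, hp, rfl⟩, rfl⟩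
  · rintro ⟨⟨_, p, hp, rfl⟩, rfl⟩
    exact ⟨p, hp, rfl⟩

end Projection

/-! ### Projections from a center disjoint from the secant variety -/

section Secant

variable {l : Fin (m + 1) → Module.Dual K (Fin (n + 1) → K)} {X : Set (ProjSpace K n)}

/-- Forms without common zero on the secant variety separate the points of the cone: the
difference of two points of the cone lies on a secant. -/
theorem NoCommonZero.eq_of_apply_eq (hl : NoCommonZero l (join X X)) {u v : Fin (n + 1) → K}
    (hu : u ∈ cone X) (hv : v ∈ cone X) (h : ∀ j, l j u = l j v) : u = v := by
  have hsub : u + (-1 : K) • v = 0 :=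
    hl _ (add_mem_cone_join hu (smul_mem_cone _ hv)) fun j => by simp [h j]
  rwa [neg_one_smul, ← sub_eq_add_neg, sub_eq_zero] at hsub

theorem NoCommonZero.of_join (hl : NoCommonZero l (join X X)) : NoCommonZero l X :=
  hl.mono (subset_join_left X X)

theorem injective_linProj (hl : NoCommonZero l (join X X)) :
    Function.Injective (linProj hl.of_join) := by
  rintro ⟨p, hp⟩ ⟨q, hq⟩ h
  obtain ⟨t, ht⟩ := (ofCoords_eq_iff _ _).1 h
  refine Subtype.ext (eq_of_coords_eq_smul (t := t) ?_)
  refine hl.eq_of_apply_eq (coords_mem_cone.2 hp) (smul_mem_cone t (coords_mem_cone.2 hq))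
    fun j => ?_
  rw [map_smul]
  exact (congrFun ht j).symm

/-- At a point with a two-dimensional tangent space, forms without common zero on the secant variety
span all linear forms together with the conormal space, as the tangent line lies in the secant
variety. -/
theorem IsCurve.span_sup_conormalSpace_eq_top [IsAlgClosed K] (hX : IsCurve X)
    (hl : NoCommonZero l (join X X)) {p : ProjSpace K n} (hp : p ∈ X)
    (hT : Module.finrank K (tangentSpace X p) = 2) :
    Submodule.span K (Set.range l) ⊔ conormalSpace X p = ⊤ := by
  have h : (Submodule.span K (Set.range l) ⊔ conormalSpace X p).dualCoannihilator = ⊥ := by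
    rw [eq_bot_iff]
    intro w hw
    rw [Submodule.mem_dualCoannihilator] at hw
    refine hl w (hX.mem_cone_join_of_mem_tangentSpace hp hT ?_) fun j =>
      hw _ (Submodule.mem_sup_left (Submodule.subset_span ⟨j, rfl⟩))
    rw [← dualCoannihilator_conormalSpace, Submodule.mem_dualCoannihilator]
    exact fun f hf => hw f (Submodule.mem_sup_right hf)
  rw [← Subspace.dualCoannihilator_dualAnnihilator_eq
    (W := Submodule.span K (Set.range l) ⊔ conormalSpace X p), h, Submodule.dualAnnihilator_bot]

theorem isClosedEmbedding_linProj [IsAlgClosed K] (hX : IsClosed X)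
    (hl : NoCommonZero l (join X X)) : IsClosedEmbedding (linProj hl.of_join) :=
  .of_continuous_injective_isClosedMap (continuous_linProj _) (injective_linProj hl)
    (isClosedMap_linProj hX _)

theorem IsCurve.range_linProj [IsAlgClosed K] (hX : IsCurve X)
    (hl : NoCommonZero l (join X X)) : IsCurve (Set.range (linProj hl.of_join)) where
  isClosed := (isClosedEmbedding_linProj hX.isClosed hl).isClosed_range
  isIrreducible := by
    have : IrreducibleSpace X := isIrreducible_iff_irreducibleSpace.1 hX.isIrreducible
    rw [← Set.image_univ]
    exact (IrreducibleSpace.isIrreducible_univ X).image _ (continuous_linProj _).continuousOn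
  dim_eq_one := by
    rw [← hX.dim_eq_one]
    exact ((isClosedEmbedding_linProj hX.isClosed hl).isEmbedding.toHomeomorph.isHomeomorph
      |>.topologicalKrullDim_eq).symm

/-- A smooth curve is isomorphic to its projection from a center disjoint from its secant variety. -/
theorem IsCurve.areIsomorphic_range_linProj [IsAlgClosed K] (hX : IsCurve X)
    (hl : NoCommonZero l (join X X)) (hs : IsSmooth X) :
    AreIsomorphic X (Set.range (linProj hl.of_join)) := by
  refine ⟨Equiv.ofInjective _ (injective_linProj hl), fun x => ?_, ?_⟩
  · refine ⟨Set.univ, isOpen_univ, Set.mem_univ _, 1, fun j => linForm (l j),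
      fun j => isHomogeneous_linForm (l j), fun y _ => ?_⟩
    simp only [eval_linForm]
    exact ⟨hl.of_join.apply_coords_ne_zero y.2, rfl⟩
  rintro ⟨_, ⟨p, hp⟩, rfl⟩
  have hT : Module.finrank K (tangentSpace X p) = 2 := by
    have h := hs p hp
    rw [hX.dim_eq_one, one_add_one_eq_two] at h
    exact_mod_cast h
  obtain ⟨d, b, c, hb, hc, hb0, hbc⟩ := exists_inverse_forms hX.isClosed hl.of_join hp
    (fun u hu h => hl.eq_of_apply_eq hu (coords_mem_cone.2 hp) h)
    (hX.span_sup_conormalSpace_eq_top hl hp hT)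
  have hzero : ∀ q : X, linProj hl.of_join q ∈ zeroLocus {b} ↔
      MvPolynomial.eval (fun j => l j (q : ProjSpace K n).coords) b = 0 := fun q => by
    simp only [zeroLocus, Set.mem_ofPred_eq, Set.mem_singleton_iff, forall_eq]
    exact eval_coords_ofCoords_eq_zero_iff hb _
  refine ⟨(zeroLocus {b})ᶜ, (isClosed_zeroLocus_singleton hb).isOpen_compl,
    fun h => hb0 ((hzero ⟨p, hp⟩).1 h), d + 1, c, hc, ?_⟩
  rintro ⟨_, q, rfl⟩ hq
  have hbq : MvPolynomial.eval (fun j => l j (q : ProjSpace K n).coords) b ≠ 0 :=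
    fun h => hq ((hzero q).2 h)
  obtain ⟨t, ht, htq⟩ := exists_coords_ofCoords (hl.of_join.apply_coords_ne_zero q.2)
  have heval : (fun i => MvPolynomial.eval (linProj hl.of_join q).coords (c i)) =
      (t ^ (d + 1) * MvPolynomial.eval (fun j => l j (q : ProjSpace K n).coords) b) •
        (q : ProjSpace K n).coords := by
    funext i
    rw [linProj, htq, eval_smul_of_isHomogeneous (hc i), ← hbc _ (coords_mem_cone.2 q.2),
      Pi.smul_apply, smul_eq_mul, mul_assoc]
  have hne : t ^ (d + 1) * MvPolynomial.eval (fun j => l j (q : ProjSpace K n).coords) b ≠ 0 :=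
    mul_ne_zero (pow_ne_zero _ ht) hbq
  have hsymm : (Equiv.ofInjective _ (injective_linProj hl)).symm ⟨linProj hl.of_join q, q, rfl⟩ =
      q := Equiv.ofInjective_symm_apply (injective_linProj hl) q
  refine ⟨?_, ?_⟩
  · rw [heval]
    exact smul_ne_zero hne q.1.coords_ne_zero
  · rw [hsymm]
    nth_rw 1 [← ofCoords_coords q.1]
    rw [ofCoords_eq_iff]
    refine ⟨(t ^ (d + 1) * MvPolynomial.eval (fun j => l j (q : ProjSpace K n).coords) b)⁻¹, ?_⟩
    rw [heval, smul_smul, inv_mul_cancel₀ hne, one_smul]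

end Secant

end ProjSpace

theorem mainTheorem8 {K : Type*} [Field K] [IsAlgClosed K] [CharZero K] {n : ℕ}
    (X : Set (ProjSpace K n)) (hX : ProjSpace.IsCurve X) :
    (topologicalKrullDim (ProjSpace.secantVariety 2 X) = 3 ↔ ¬ ProjSpace.LiesInPlane X) ∧
    (ProjSpace.IsSmooth X →
      ∃ Y : Set (ProjSpace K 3), ProjSpace.IsCurve Y ∧ ProjSpace.AreIsomorphic X Y) := by
  rw [ProjSpace.secantVariety_two X hX.isIrreducible.nonempty]
  refine ⟨hX.dim_join_eq_three_iff, fun hs => ?_⟩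
  obtain ⟨l, hl⟩ := ProjSpace.exists_noCommonZero (ProjSpace.isClosed_join X X)
    hX.dim_join_lt_four
  exact ⟨_, hX.range_linProj hl, hX.areIsomorphic_range_linProj hl hs⟩
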